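/- Let $a,c$ be nonzero complex numbers such that $c(c-a)\in\mathbb R$ and $|c|\ge 2|c-a|$. For $m\ge 0$ let $A^{a,c}_{m,m+1}(z_0,z_1)$ be the $m\times(m+1)$ matrix, with rows numbered $0,\dots,m-1$ and columns numbered $0,\dots,m$, whose entries $(i,j)$ are: $z_0$ if $j=i$; $z_1$ if $j=i+1$; $\bar c$ if $j=i+2$ and $i\ge 1$; $\bar a$ if $(i,j)=(0,2)$; $c$ if $j=i-1$ and $i\le m-2$; $a$ if $(i,j)=(m-1,m-2)$; and $0$ otherwise. For $0\le k\le m$ let $Q_k^m(z_0,z_1)$ be the determinant of the matrix obtained from $A^{a,c}_{m,m+1}(z_0,z_1)$ by deleting column $m-k$ (so $Q_0^0=1$). Then for every $m\ge 0$ the polynomials $Q_0^m,\dots,Q_m^m$ have exactly $\dim\Pi^2_{m-1}$ common zeros $(z_0,z_1)$ in $\mathbb C^2$, where $\Pi^2_{m-1}$ is the space of real polynomials in two variables of total degree at most $m-1$ (with $\Pi^2_{-1}=\{0\}$). Every common zero is real, meaning $z_1=\overline{z_0}$, so that it is a zero of all the $Q_k^m(z,\bar z)$; and every common zero is simple, meaning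 that the Jacobian matrix of $(Q_0^m,\dots,Q_m^m)$ with respect to $(z_0,z_1)$ has rank $2$ there. -/

import Mathlib

open MvPolynomial ComplexConjugate

namespace GenChar

/-- The `s`-unit matrix `(δ_{s+i-j})` of size `m × (m + 1)`. -/
def unitMatrix (R : Type*) [Zero R] [One R] (m s : ℕ) : Matrix (Fin m) (Fin (m + 1)) R :=
  Matrix.of fun i j => if s + (i : ℕ) = (j : ℕ) then 1 else 0

/-- The matrix `A(z₀, z₁) = A + z₀ I₀ + z₁ I₁`, where `z₀, z₁` are indeterminates. -/
noncomputable def shifted {m : ℕ} (A : Matrix (Fin m) (Fin (m + 1)) ℂ) :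
    Matrix (Fin m) (Fin (m + 1)) (MvPolynomial (Fin 2) ℂ) :=
  A.map (C : ℂ → MvPolynomial (Fin 2) ℂ)
    + (X 0 : MvPolynomial (Fin 2) ℂ) • unitMatrix (MvPolynomial (Fin 2) ℂ) m 0
    + (X 1 : MvPolynomial (Fin 2) ℂ) • unitMatrix (MvPolynomial (Fin 2) ℂ) m 1

/-- The `k`-th generalized characteristic polynomial of `A`, `0 ≤ k ≤ m`: the determinant of
`A(z₀, z₁)` with its column of index `m - k` removed, the columns being numbered `0, …, m`
(`k.rev` is `m - k`). Its leading form is `z₀ ^ (m - k) * z₁ ^ k`. -/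
noncomputable def charPoly {m : ℕ} (A : Matrix (Fin m) (Fin (m + 1)) ℂ) (k : Fin (m + 1)) :
    MvPolynomial (Fin 2) ℂ :=
  ((shifted A).submatrix id k.rev.succAbove).det

/-- The perturbed centrohermitian Toeplitz matrix `A^{a,c}_{m,m+1}` (its `z`-free part): `c` on the
subdiagonal and `conj c` on the second superdiagonal, except that the entry of the second
superdiagonal in the first row is `conj a` and the entry of the subdiagonal in the last row
is `a`. -/
noncomputable def perturbedToeplitz (a c : ℂ) (m : ℕ) : Matrix (Fin m) (Fin (m + 1)) ℂ :=
  Matrix.of fun i j =>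
    if (j : ℕ) = (i : ℕ) + 2 then (if (i : ℕ) = 0 then conj a else conj c)
    else if (i : ℕ) = (j : ℕ) + 1 then (if (i : ℕ) + 1 = m then a else c)
    else 0

/-- The polynomials `Q_k^m`, as polynomials in two variables `z₀ = z`, `z₁ = z̄`. -/
noncomputable def Q (a c : ℂ) (m : ℕ) (k : Fin (m + 1)) : MvPolynomial (Fin 2) ℂ :=
  charPoly (perturbedToeplitz a c m) k

/-- The common zeros in `ℂ²` of a family of polynomials in two independent complex variables. -/
def commonZeros {ι : Type*} (P : ι → MvPolynomial (Fin 2) ℂ) : Set (Fin 2 → ℂ) :=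
  {p | ∀ k, eval p (P k) = 0}

/-- A point `(z₀, z₁)` is real in conjugate complex variables if it has the form `(z, z̄)` (so that
it comes from the point `(re z, im z)` of `ℝ²`). -/
def IsRealPoint (p : Fin 2 → ℂ) : Prop :=
  p 1 = conj (p 0)

/-- A common zero `p` of the family `P` is simple (of multiplicity one) if the Jacobian matrix of
`P` at `p` has rank two: the vectors `∂P/∂z₀ (p)` and `∂P/∂z₁ (p)` are linearly independent.
In particular neither of these partial derivatives vanishes. -/
def IsSimpleZero {ι : Type*} (P : ι → MvPolynomial (Fin 2) ℂ) (p : Fin 2 → ℂ) : Prop :=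
  LinearIndependent ℂ fun (i : Fin 2) (k : ι) => eval p (pderiv i (P k))

/-- The space `Π²_{m-1}` of real polynomials in two variables of total degree at most `m - 1`, that
is, all of whose monomials have degree `< m`; for `m = 0` it is the zero space. -/
noncomputable def polyDegLT (m : ℕ) : Submodule ℝ (MvPolynomial (Fin 2) ℝ) :=
  restrictSupport ℝ {n : Fin 2 →₀ ℕ | n.degree < m}

end GenChar

/-! The `Q k` of size `m` are orthogonal polynomials of degree `m` for a positive weight on a
deltoid, and their common zeros are the joint spectrum of a commuting normal pair, i.e. the nodes of
a Gaussian cubature.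

With `b = (a - c) / c` and `κ ^ 2 = c * conj κ`, write `z₀ = κ e₂(t)` and `z₁ = conj κ e₁(t)`, where
`t` runs over the maximal torus of `SU(3)`. Then `Q k` times the Vandermonde determinant of `t` is a
constant times a `3 × 3` alternant (`exists_eval_Q_mul_vand`). Since `‖b‖ < 1`, the weight `|vand
t|² / |∏ (1 + conj b t_i³)|²` is defined on the whole torus, and Cauchy's theorem along
one-parameter rotations makes each `Q k` orthogonal to all lower degrees
(`inner_weightedEmbedding_Q`).

Compressing multiplication by `z₀` and `z₁` to polynomials of degree `< m` gives mutually adjoint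
operators. The linear syzygies between the maximal minors (`charPoly_syzygy`) make them commute, so
joint eigenvectors span the space. Each joint eigenvector not orthogonal to `1` yields a real common
zero, and these zeros separate degree `< m` (`separating_of_orthogonal`). As the leading forms are
all the monomials of degree `m`, separation forces the ideal to be radical with exactly the expected
number of zeros (`commonZeros_of_separating`). -/

namespace GenChar

/-! ### Filtration of the polynomial ring by degree. -/

/-- Complex polynomials in two variables all of whose monomials have degree `< m`. -/
noncomputable def degLT (m : ℕ) : Submodule ℂ (MvPolynomial (Fin 2) ℂ) :=
  restrictSupport ℂ {n : Fin 2 →₀ ℕ | n.degree < m}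

lemma degLT_mono {a b : ℕ} (h : a ≤ b) : degLT a ≤ degLT b :=
  restrictSupport_mono ℂ fun _ hn => lt_of_lt_of_le hn h

lemma mul_mem_degLT {a b : ℕ} {f g : MvPolynomial (Fin 2) ℂ} (hf : f ∈ degLT a)
    (hg : g ∈ degLT (b + 1)) : f * g ∈ degLT (a + b) := by
  have h := Submodule.mul_mem_mul hf hg
  rw [degLT, degLT, ← restrictSupport_add] at h
  refine restrictSupport_mono ℂ ?_ h
  rintro _ ⟨x, hx, y, hy, rfl⟩
  simp only [Set.mem_ofPred_eq, map_add] at *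
  omega

lemma monomial_mem_degLT {m : ℕ} {n : Fin 2 →₀ ℕ} (h : n.degree < m) (r : ℂ) :
    monomial n r ∈ degLT m :=
  (monomial_mem_restrictSupport ℂ).2 (Or.inl h)

lemma C_mem_degLT (r : ℂ) : (C r : MvPolynomial (Fin 2) ℂ) ∈ degLT 1 :=
  monomial_mem_degLT (by simp) r

lemma X_mem_degLT (i : Fin 2) : (X i : MvPolynomial (Fin 2) ℂ) ∈ degLT 2 :=
  monomial_mem_degLT (by simp) 1

lemma one_mem_degLT : (1 : MvPolynomial (Fin 2) ℂ) ∈ degLT 1 := C_mem_degLT 1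

lemma degLT_induction {m : ℕ} {p : MvPolynomial (Fin 2) ℂ → Prop}
    (hmon : ∀ i j, i + j < m → p (X 0 ^ i * X 1 ^ j)) (hzero : p 0)
    (hadd : ∀ f g, p f → p g → p (f + g)) (hsmul : ∀ (r : ℂ) f, p f → p (r • f)) :
    ∀ f ∈ degLT m, p f := by
  intro f hf
  rw [degLT, restrictSupport_eq_span] at hf
  refine Submodule.span_induction ?_ hzero (fun f g _ _ => hadd f g) (fun r f _ => hsmul r f) hf
  rintro _ ⟨n, hn, rfl⟩
  have h := hmon (n 0) (n 1) (by simpa [Finsupp.degree_eq_sum] using hn)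
  convert h using 1
  dsimp only
  rw [monomial_eq, Finsupp.prod_fintype _ _ (by simp)]
  simp

lemma pow_mul_pow_mem_degLT {m i j : ℕ} (h : i + j < m) :
    (X 0 ^ i * X 1 ^ j : MvPolynomial (Fin 2) ℂ) ∈ degLT m := by
  have : (X 0 ^ i * X 1 ^ j : MvPolynomial (Fin 2) ℂ)
      = monomial (Finsupp.single 0 i + Finsupp.single 1 j) 1 := by
    rw [X_pow_eq_monomial, X_pow_eq_monomial, monomial_mul, one_mul]
  rw [this]
  exact monomial_mem_degLT (by simpa using h) 1

instance finiteDimensional_degLT (m : ℕ) : FiniteDimensional ℂ (degLT m) := by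
  have : Finite {n : Fin 2 →₀ ℕ | n.degree < m} := by
    refine Set.Finite.to_subtype (Set.Finite.of_injOn (f := fun n : Fin 2 →₀ ℕ => (n 0, n 1))
      (t := Set.Iio m ×ˢ Set.Iio m) ?_ ?_ ((Set.finite_Iio m).prod (Set.finite_Iio m)))
    · intro n hn
      simp only [Set.mem_ofPred_eq, Finsupp.degree_eq_sum, Fin.sum_univ_two] at hn
      simp only [Set.mem_prod, Set.mem_Iio]
      omega
    · intro n _ n' _ h
      ext i
      simp only [Prod.mk.injEq] at h
      fin_cases i
      exacts [h.1, h.2]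
  exact Module.Finite.of_basis (basisRestrictSupport ℂ {n : Fin 2 →₀ ℕ | n.degree < m})

lemma finrank_degLT (m : ℕ) : Module.finrank ℂ (degLT m) = Module.finrank ℝ (polyDegLT m) := by
  exact (Module.finrank_eq_nat_card_basis (basisRestrictSupport ℂ _)).trans
    (Module.finrank_eq_nat_card_basis (basisRestrictSupport ℝ _)).symm

/-! ### From separation to the number, reality and simplicity of the zeros. -/

section Reduction

variable {m : ℕ} {Q : Fin (m + 1) → MvPolynomial (Fin 2) ℂ}

/-- Division with remainder: every monomial of degree at least `m` is divisible by some leading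
form, and replacing that form by its difference with `Q k` lowers the degree. -/
lemma exists_sub_mem_span (hlead : ∀ k : Fin (m + 1),
      Q k - X 0 ^ (m - k : ℕ) * X 1 ^ (k : ℕ) ∈ degLT m) (f : MvPolynomial (Fin 2) ℂ) :
    ∃ g ∈ degLT m, f - g ∈ Ideal.span (Set.range Q) := by
  have key : ∀ d, ∀ f ∈ degLT d, ∃ g ∈ degLT m, f - g ∈ Ideal.span (Set.range Q) := by
    intro d
    induction d with
    | zero =>
      refine degLT_induction (by simp) ⟨0, zero_mem _, by simp⟩ ?_ ?_
      · rintro f f' ⟨g, hg, h⟩ ⟨g', hg', h'⟩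
        exact ⟨g + g', add_mem hg hg', by convert add_mem h h' using 1; ring⟩
      · rintro r f ⟨g, hg, h⟩
        refine ⟨r • g, Submodule.smul_mem _ _ hg, ?_⟩
        rw [← smul_sub, smul_eq_C_mul]
        exact Ideal.mul_mem_left _ _ h
    | succ d ih =>
      refine degLT_induction ?_ ⟨0, zero_mem _, by simp⟩ ?_ ?_
      · intro i j hij
        by_cases hm : i + j < m
        · exact ⟨_, pow_mul_pow_mem_degLT hm, by simp⟩
        -- The leading form to divide by is the one with `k = min j m`.
        · obtain ⟨k, i', j', hi, hj, hk⟩ : ∃ (k : ℕ) (i' j' : ℕ), i = i' + (m - k) ∧ j = j' + k ∧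
              k ≤ m := by
            by_cases hj : j ≤ m
            · exact ⟨j, i - (m - j), 0, by omega, by omega, hj⟩
            · exact ⟨m, i, j - m, by omega, by omega, le_rfl⟩
          have hl := hlead ⟨k, by omega⟩
          simp only at hl
          have hlow : X 0 ^ i' * X 1 ^ j' * (Q ⟨k, by omega⟩ - X 0 ^ (m - k) * X 1 ^ k)
              ∈ degLT d := by
            rw [mul_comm]
            exact degLT_mono (by omega) (mul_mem_degLT (b := i' + j') hl
              (pow_mul_pow_mem_degLT (by omega)))
          obtain ⟨g, hg, h⟩ := ih _ hlow
          refine ⟨-g, neg_mem hg, ?_⟩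
          have hQ : X 0 ^ i' * X 1 ^ j' * Q ⟨k, by omega⟩ ∈ Ideal.span (Set.range Q) :=
            Ideal.mul_mem_left _ _ (Ideal.subset_span ⟨_, rfl⟩)
          convert sub_mem hQ h using 1
          rw [hi, hj]
          ring
      · rintro f f' ⟨g, hg, h⟩ ⟨g', hg', h'⟩
        exact ⟨g + g', add_mem hg hg', by convert add_mem h h' using 1; ring⟩
      · rintro r f ⟨g, hg, h⟩
        refine ⟨r • g, Submodule.smul_mem _ _ hg, ?_⟩
        rw [← smul_sub, smul_eq_C_mul]
        exact Ideal.mul_mem_left _ _ h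
  refine key (f.totalDegree + 1) f ?_
  rw [degLT, mem_restrictSupport_iff]
  intro n hn
  have := le_totalDegree (Finset.mem_coe.1 hn)
  rw [Set.mem_ofPred_eq, Finsupp.degree_eq_sum]
  rw [Finsupp.sum_fintype _ _ (by simp)] at this
  omega

lemma eval_eq_zero_of_mem_span {f : MvPolynomial (Fin 2) ℂ} (hf : f ∈ Ideal.span (Set.range Q))
    {p : Fin 2 → ℂ} (hp : p ∈ commonZeros Q) : eval p f = 0 := by
  have : Ideal.span (Set.range Q) ≤ RingHom.ker (eval p) := by
    rw [Ideal.span_le]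
    rintro _ ⟨k, rfl⟩
    exact hp k
  exact this hf

lemma exists_eval_one_eval_zero (S : Finset (Fin 2 → ℂ)) (q : Fin 2 → ℂ) (hq : q ∉ S) :
    ∃ f : MvPolynomial (Fin 2) ℂ, eval q f = 1 ∧ ∀ p ∈ S, eval p f = 0 := by
  have h : ∀ p ∈ S, ∃ f : MvPolynomial (Fin 2) ℂ, eval q f = 1 ∧ eval p f = 0 := by
    intro p hp
    obtain ⟨i, hi⟩ : ∃ i, q i ≠ p i := by
      by_contra! h
      exact hq (funext h ▸ hp)
    refine ⟨(X i - C (p i)) * C ((q i - p i)⁻¹), ?_, by simp⟩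
    simp [mul_inv_cancel₀ (sub_ne_zero.2 hi)]
  choose! F hF using h
  refine ⟨∏ p ∈ S, F p, ?_, fun p hp => ?_⟩
  · rw [map_prod]
    exact Finset.prod_eq_one fun p hp => (hF p hp).1
  · rw [map_prod]
    exact Finset.prod_eq_zero hp (hF p hp).2

/-- Interpolation on `S` is possible with arbitrary polynomials, and passing to the remainder modulo
the ideal changes no value on `S`; so degree `< m` already interpolates. -/
lemma card_le_finrank_degLT (hlead : ∀ k : Fin (m + 1),
      Q k - X 0 ^ (m - k : ℕ) * X 1 ^ (k : ℕ) ∈ degLT m) (S : Finset (Fin 2 → ℂ))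
    (hS : ↑S ⊆ commonZeros Q) : S.card ≤ Module.finrank ℂ (degLT m) := by
  let ev : degLT m →ₗ[ℂ] (S → ℂ) := LinearMap.pi fun p =>
    (aeval (R := ℂ) (p : Fin 2 → ℂ)).toLinearMap ∘ₗ (degLT m).subtype
  have hev : ∀ f p, ev f p = eval (p : Fin 2 → ℂ) (f : MvPolynomial (Fin 2) ℂ) := fun f p => by
    simp [ev, aeval_eq_eval]
  have hsurj : Function.Surjective ev := by
    have hsingle : ∀ q : S, ∃ g : degLT m, ev g = Pi.single q 1 := by
      intro q
      obtain ⟨f, hf1, hf0⟩ := exists_eval_one_eval_zero (S.erase q) q (by simp)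
      obtain ⟨g, hg, hfg⟩ := exists_sub_mem_span hlead f
      refine ⟨⟨g, hg⟩, funext fun p => ?_⟩
      have h := eval_eq_zero_of_mem_span hfg (hS p.2)
      rw [map_sub, sub_eq_zero] at h
      rw [hev, ← h]
      by_cases hpq : p = q
      · subst hpq; simp [hf1]
      · rw [Pi.single_eq_of_ne hpq]
        exact hf0 p (Finset.mem_erase.2 ⟨fun h => hpq (Subtype.ext h), p.2⟩)
    choose g hg using hsingle
    intro v
    refine ⟨∑ q, v q • g q, ?_⟩
    rw [map_sum]
    simp only [map_smul, hg]
    ext p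
    simp [Finset.sum_apply, Pi.single_apply]
  simpa using LinearMap.finrank_le_finrank_of_surjective hsurj

/-- If the polynomials `Q k` have leading forms `z₀ ^ (m - k) * z₁ ^ k`, and if their real common
zeros separate the polynomials of degree `< m`, then they have the maximal number of common zeros,
all of them real and simple. -/
theorem commonZeros_of_separating
    (hlead : ∀ k : Fin (m + 1), Q k - X 0 ^ (m - k : ℕ) * X 1 ^ (k : ℕ) ∈ degLT m)
    (hsep : ∀ g ∈ degLT m, (∀ p ∈ commonZeros Q, IsRealPoint p → eval p g = 0) → g = 0) :
    (commonZeros Q).encard = (Module.finrank ℝ (polyDegLT m) : ℕ∞) ∧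
      ∀ p ∈ commonZeros Q, IsRealPoint p ∧ IsSimpleZero Q p := by
  classical
  rw [← finrank_degLT]
  have hfin : (commonZeros Q).Finite := by
    by_contra hinf
    obtain ⟨S, hS, hcard⟩ := Set.Infinite.exists_subset_card_eq hinf
      (Module.finrank ℂ (degLT m) + 1)
    have := card_le_finrank_degLT hlead S hS
    omega
  -- The remainder of such an `f` also vanishes at the real zeros, hence is zero by separation.
  have hmem : ∀ f : MvPolynomial (Fin 2) ℂ,
      (∀ p ∈ commonZeros Q, IsRealPoint p → eval p f = 0) → f ∈ Ideal.span (Set.range Q) := by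
    intro f hf
    obtain ⟨g, hg, hfg⟩ := exists_sub_mem_span hlead f
    have : g = 0 := hsep g hg fun p hp hr => by
      have h := eval_eq_zero_of_mem_span hfg hp
      rw [map_sub, hf p hp hr, zero_sub, neg_eq_zero] at h
      exact h
    simpa [this] using hfg
  lift commonZeros Q to Finset (Fin 2 → ℂ) using hfin with S hS
  -- An interpolant equal to `1` at a non-real zero and `0` at the real ones would lie in the ideal
  -- and so vanish at that zero.
  have hreal : ∀ p ∈ S, IsRealPoint p := by
    intro q hq
    by_contra hnr
    obtain ⟨f, hf1, hf0⟩ := exists_eval_one_eval_zero (S.filter IsRealPoint) q (by simp [hnr])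
    have h0 : eval q f = 0 := eval_eq_zero_of_mem_span
      (hmem f fun p hp hr => hf0 p (Finset.mem_filter.2 ⟨hp, hr⟩)) (hS ▸ hq)
    rw [hf1] at h0
    exact one_ne_zero h0
  refine ⟨?_, fun p hp => ⟨hreal p hp, ?_⟩⟩
  · rw [Set.encard_coe_eq_coe_finsetCard, Nat.cast_inj]
    refine le_antisymm (card_le_finrank_degLT hlead S hS.le) ?_
    let ev : degLT m →ₗ[ℂ] (S → ℂ) := LinearMap.pi fun p =>
      (aeval (R := ℂ) (p : Fin 2 → ℂ)).toLinearMap ∘ₗ (degLT m).subtype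
    have hinj : Function.Injective ev := by
      rw [← LinearMap.ker_eq_bot, LinearMap.ker_eq_bot']
      intro g hg
      refine Subtype.ext (hsep g g.2 fun p hp _ => ?_)
      have := congrFun hg ⟨p, hp⟩
      simpa [ev, aeval_eq_eval] using this
    simpa using LinearMap.finrank_le_finrank_of_injective hinj
  · obtain ⟨f, hf1, hf0⟩ := exists_eval_one_eval_zero (S.erase p) p (by simp)
    -- This product vanishes at every common zero. Writing it as a combination of the `Q k` and
    -- differentiating at `p` shows that the Jacobian has a one-sided inverse.
    have hI : ∀ i : Fin 2, (X i - C (p i)) * f ∈ Ideal.span (Set.range Q) := by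
      intro i
      refine hmem _ fun q hq _ => ?_
      by_cases hqp : q = p
      · simp [hqp]
      · rw [map_mul, hf0 q (Finset.mem_erase.2 ⟨hqp, hq⟩), mul_zero]
    have hcoef : ∀ i : Fin 2, ∃ h : Fin (m + 1) → ℂ, ∀ j : Fin 2,
        ∑ k, h k * eval p (pderiv j (Q k)) = if i = j then 1 else 0 := by
      intro i
      obtain ⟨h, hh⟩ := (Ideal.mem_span_range_iff_exists_fun).1 (hI i)
      refine ⟨fun k => eval p (h k), fun j => ?_⟩
      have hp' : ∀ k, eval p (Q k) = 0 := by
        have : p ∈ commonZeros Q := hS ▸ hp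
        exact this
      have h1 := congrArg (fun g => eval p (pderiv j g)) hh
      simp only [map_sum, pderiv_mul, map_add, map_mul, hp', mul_zero, zero_add, map_sub, eval_X,
        eval_C, sub_self, zero_mul, add_zero, pderiv_C, sub_zero, hf1, mul_one] at h1
      rw [h1, pderiv_X]
      by_cases hij : i = j
      · subst hij; simp
      · simp [hij]
    rw [IsSimpleZero, Fintype.linearIndependent_iff]
    intro c hc i
    obtain ⟨h, hh⟩ := hcoef i
    have h1 : ∑ k, h k * (∑ j, c j • fun k => eval p (pderiv j (Q k))) k = 0 := by
      rw [hc]; simp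
    simp only [Fin.sum_univ_two, Pi.add_apply, Pi.smul_apply, smul_eq_mul] at h1
    have h2 : c 0 * (∑ k, h k * eval p (pderiv 0 (Q k)))
        + c 1 * (∑ k, h k * eval p (pderiv 1 (Q k))) = 0 := by
      rw [← h1, Finset.mul_sum, Finset.mul_sum, ← Finset.sum_add_distrib]
      exact Finset.sum_congr rfl fun k _ => by ring
    rw [hh, hh] at h2
    fin_cases i <;> simpa using h2

end Reduction

/-! ### Leading forms of the generalized characteristic polynomials. -/

section LeadingForm

lemma sub_prod_mem_degLT {ι : Type*} (s : Finset ι) (f g : ι → MvPolynomial (Fin 2) ℂ)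
    (hg : ∀ i ∈ s, g i ∈ degLT 2) (hfg : ∀ i ∈ s, f i - g i ∈ degLT 1) :
    ∏ i ∈ s, g i ∈ degLT (s.card + 1) ∧ ∏ i ∈ s, f i - ∏ i ∈ s, g i ∈ degLT s.card := by
  classical
  induction s using Finset.induction_on with
  | empty => simpa using one_mem_degLT
  | insert a s ha ih =>
    obtain ⟨h1, h2⟩ := ih (fun i hi => hg i (Finset.mem_insert_of_mem hi))
      (fun i hi => hfg i (Finset.mem_insert_of_mem hi))
    have hga := hg a (Finset.mem_insert_self _ _)
    have hfa := hfg a (Finset.mem_insert_self _ _)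
    rw [Finset.prod_insert ha, Finset.prod_insert ha, Finset.card_insert_of_notMem ha]
    constructor
    · rw [mul_comm]
      exact mul_mem_degLT h1 hga
    · have h3 : (f a - g a) * ∏ i ∈ s, g i ∈ degLT (1 + s.card) := mul_mem_degLT hfa h1
      have h4 : (∏ i ∈ s, f i - ∏ i ∈ s, g i) * g a ∈ degLT (s.card + 1) := mul_mem_degLT h2 hga
      have h5 : (∏ i ∈ s, f i - ∏ i ∈ s, g i) * (f a - g a) ∈ degLT (s.card + 1) :=
        degLT_mono (by omega) (mul_mem_degLT (b := 0) h2 hfa)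
      rw [add_comm] at h3
      convert add_mem (add_mem h3 h4) h5 using 1
      ring

lemma det_sub_det_mem_degLT {m : ℕ} (M N : Matrix (Fin m) (Fin m) (MvPolynomial (Fin 2) ℂ))
    (hN : ∀ i j, N i j ∈ degLT 2) (hMN : ∀ i j, M i j - N i j ∈ degLT 1) :
    M.det - N.det ∈ degLT m := by
  rw [Matrix.det_apply', Matrix.det_apply', ← Finset.sum_sub_distrib]
  refine sum_mem fun σ _ => ?_
  rw [← mul_sub]
  have h := (sub_prod_mem_degLT Finset.univ (fun i => M (σ i) i) (fun i => N (σ i) i)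
    (fun i _ => hN _ _) (fun i _ => hMN _ _)).2
  rw [Finset.card_univ, Fintype.card_fin] at h
  rcases Int.units_eq_one_or (Equiv.Perm.sign σ) with h' | h' <;> simp only [h']
  · simpa using h
  · simpa using neg_mem h

/-- Deleting column `j` decouples the indices below `j` from the others: the first block is upper
triangular with diagonal `x`, the second lower triangular with diagonal `y`. -/
lemma det_bidiagonal {m : ℕ} (x y : MvPolynomial (Fin 2) ℂ) (j : Fin (m + 1)) :
    ((x • unitMatrix (MvPolynomial (Fin 2) ℂ) m 0
      + y • unitMatrix (MvPolynomial (Fin 2) ℂ) m 1).submatrix id j.succAbove).det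
      = x ^ (j : ℕ) * y ^ (m - j : ℕ) := by
  set M := (x • unitMatrix (MvPolynomial (Fin 2) ℂ) m 0
      + y • unitMatrix (MvPolynomial (Fin 2) ℂ) m 1).submatrix id j.succAbove with hM
  have hval : ∀ k : Fin m, ((j.succAbove k : Fin (m + 1)) : ℕ)
      = if (k : ℕ) < j then (k : ℕ) else k + 1 := by
    intro k
    simp only [Fin.succAbove, Fin.lt_def, Fin.val_castSucc]
    split_ifs <;> simp
  have hMv : ∀ i k : Fin m, M i k =
      x * (if (i : ℕ) = (if (k : ℕ) < j then (k : ℕ) else k + 1) then 1 else 0)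
      + y * (if 1 + (i : ℕ) = (if (k : ℕ) < j then (k : ℕ) else k + 1) then 1 else 0) := by
    intro i k
    simp [hM, unitMatrix, hval]
  have hj := j.2
  have hcard : Fintype.card {i : Fin m // (i : ℕ) < j} = j := by
    rw [Fintype.card_subtype, Fin.card_filter_val_lt]
    omega
  rw [Matrix.twoBlockTriangular_det M (fun i => (i : ℕ) < j) (fun i hi k hk => by
    rw [hMv]; split_ifs <;> first | omega | simp)]
  congr 1
  · rw [Matrix.det_of_isUpperTriangular]
    · rw [Finset.prod_congr rfl (g := fun _ => x), Finset.prod_const]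
      · congr 1
      · intro i _
        have := i.2
        simp only [Matrix.toSquareBlockProp_def, Matrix.of_apply, hMv]
        split_ifs <;> first | omega | simp
    · intro i k hik
      have := i.2
      have := k.2
      have hik : (k.1 : ℕ) < i.1 := hik
      simp only [Matrix.toSquareBlockProp_def, Matrix.of_apply, hMv]
      split_ifs <;> first | omega | simp
  · rw [Matrix.det_of_isLowerTriangular]
    · rw [Finset.prod_congr rfl (g := fun _ => y), Finset.prod_const]
      · congr 1
        rw [Finset.card_univ, Fintype.card_subtype_compl, hcard, Fintype.card_fin]
      · intro i _
        have := i.2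
        simp only [Matrix.toSquareBlockProp_def, Matrix.of_apply, hMv]
        split_ifs <;> first | omega | simp
    · intro i k hik
      have := i.2
      have := k.2
      have hik : (i.1 : ℕ) < k.1 := hik
      simp only [Matrix.toSquareBlockProp_def, Matrix.of_apply, hMv]
      split_ifs <;> first | omega | simp

theorem charPoly_sub_leading_mem_degLT {m : ℕ} (A : Matrix (Fin m) (Fin (m + 1)) ℂ)
    (k : Fin (m + 1)) :
    charPoly A k - X 0 ^ (m - k : ℕ) * X 1 ^ (k : ℕ) ∈ degLT m := by
  have hk := k.2
  have h := det_bidiagonal (X 0) (X 1) k.rev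
  rw [show (k.rev : ℕ) = m - k by rw [Fin.val_rev]; omega, show m - (m - (k : ℕ)) = k by omega] at h
  rw [← h]
  refine det_sub_det_mem_degLT _ _ (fun i j => ?_) fun i j => ?_
  · have hX : ∀ i : Fin 2, ∀ c : Prop, [Decidable c] →
        X i * (if c then 1 else 0 : MvPolynomial (Fin 2) ℂ) ∈ degLT 2 := by
      intro i c _
      split_ifs
      · simpa using X_mem_degLT i
      · simp
    simpa [unitMatrix] using add_mem (hX 0 _) (hX 1 _)
  · convert C_mem_degLT (A i (k.rev.succAbove j)) using 1
    simp [shifted]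

end LeadingForm

/-! ### Linear relations between maximal minors. -/

section Syzygy

variable {m : ℕ}

/-- Laplace expansion along the top row of the square matrix obtained by repeating row `i` on top.
-/
lemma sum_minors_eq_zero {R : Type*} [CommRing R] (A : Matrix (Fin m) (Fin (m + 1)) R)
    (i : Fin m) :
    ∑ j : Fin (m + 1), (-1) ^ (j : ℕ) * A i j * (A.submatrix id j.succAbove).det = 0 := by
  have h0 : (Matrix.of (Fin.cons (A i) A : Fin (m + 1) → Fin (m + 1) → R)).det = 0 := by
    refine Matrix.det_zero_of_row_eq (i := 0) (j := i.succ) (Fin.succ_ne_zero i).symm ?_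
    ext j
    rfl
  rw [Matrix.det_succ_row_zero] at h0
  rw [← h0]
  rfl

/-- In the minor relation of row `k.rev` the indeterminates occur only in two adjacent columns,
whose signs are opposite; all other contributions have constant coefficients. -/
theorem charPoly_syzygy (A : Matrix (Fin m) (Fin (m + 1)) ℂ) (k : Fin m) :
    X 0 * charPoly A k.succ - X 1 * charPoly A k.castSucc
      ∈ Submodule.span ℂ (Set.range (charPoly A)) := by
  have h := sum_minors_eq_zero (shifted A) k.rev
  have hsplit : ∀ j : Fin (m + 1), (-1) ^ (j : ℕ) * shifted A k.rev j
        * ((shifted A).submatrix id j.succAbove).det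
      = ((-1) ^ (j : ℕ) * A k.rev j) • charPoly A j.rev
        + (if j = k.succ.rev then (-1) ^ (j : ℕ) * X 0 * charPoly A j.rev else 0)
        + (if j = k.castSucc.rev then (-1) ^ (j : ℕ) * X 1 * charPoly A j.rev else 0) := by
    intro j
    have e : ((shifted A).submatrix id j.succAbove).det = charPoly A j.rev := by
      simp [charPoly]
    rw [e]
    have e0 : (0 + ((k.rev : Fin m) : ℕ) = j) ↔ j = k.succ.rev := by
      rw [Fin.ext_iff]; simp only [Fin.val_rev, Fin.val_succ]; omega
    have e1 : (1 + ((k.rev : Fin m) : ℕ) = j) ↔ j = k.castSucc.rev := by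
      rw [Fin.ext_iff]; simp only [Fin.val_rev, Fin.val_castSucc]; omega
    simp only [shifted, Matrix.add_apply, Matrix.smul_apply, Matrix.map_apply, unitMatrix,
      Matrix.of_apply, e0, e1, smul_eq_mul, smul_eq_C_mul, map_mul, map_pow, map_neg, map_one]
    split_ifs <;> ring
  simp only [hsplit, Finset.sum_add_distrib, Finset.sum_ite_eq', Finset.mem_univ, if_true,
    Fin.rev_rev] at h
  have hs : ((k.castSucc.rev : Fin (m + 1)) : ℕ) = ((k.succ.rev : Fin (m + 1)) : ℕ) + 1 := by
    simp only [Fin.val_rev, Fin.val_castSucc, Fin.val_succ]; omega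
  rw [hs] at h
  have hmem : ∑ j : Fin (m + 1), ((-1) ^ (j : ℕ) * A k.rev j) • charPoly A j.rev
      ∈ Submodule.span ℂ (Set.range (charPoly A)) :=
    sum_mem fun j _ => Submodule.smul_mem _ _ (Submodule.subset_span ⟨_, rfl⟩)
  rcases neg_one_pow_eq_or (MvPolynomial (Fin 2) ℂ) ((k.succ.rev : Fin (m + 1)) : ℕ) with e | e
  · rw [pow_succ, e] at h
    convert neg_mem hmem using 1
    linear_combination h
  · rw [pow_succ, e] at h
    convert hmem using 1
    linear_combination -h

end Syzygy

/-! ### Common zeros as the joint spectrum of compressed multiplications. -/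

section Spectral

variable {H : Type*} [NormedAddCommGroup H] [InnerProductSpace ℂ H]
  {m : ℕ} {Q : Fin (m + 1) → MvPolynomial (Fin 2) ℂ}

open Module.End in
/-- Polynomials of degree `m` orthogonal to those of lower degree whose two compressed
multiplication operators commute have enough real common zeros to separate the polynomials
of lower degree. -/
theorem separating_of_orthogonal (ι : MvPolynomial (Fin 2) ℂ →ₗ[ℂ] H)
    (hinj : Function.Injective ι)
    (hadj : ∀ f g, inner ℂ (ι (X 0 * f)) (ι g) = inner ℂ (ι f) (ι (X 1 * g)))
    (hlead : ∀ k : Fin (m + 1), Q k - X 0 ^ (m - k : ℕ) * X 1 ^ (k : ℕ) ∈ degLT m)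
    (hsyz : ∀ k : Fin m, X 0 * Q k.succ - X 1 * Q k.castSucc ∈ Submodule.span ℂ (Set.range Q))
    (horth : ∀ k, ∀ f ∈ degLT m, inner ℂ (ι f) (ι (Q k)) = 0) :
    ∀ g ∈ degLT m, (∀ p ∈ commonZeros Q, IsRealPoint p → eval p g = 0) → g = 0 := by
  classical
  let W : Submodule ℂ H := (degLT m).map ι
  have : FiniteDimensional ℂ W := inferInstanceAs (FiniteDimensional ℂ ((degLT m).map ι))
  let e : degLT m ≃ₗ[ℂ] W := Submodule.equivMapOfInjective ι hinj (degLT m)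
  have he : ∀ f, ((e f : W) : H) = ι f := fun f => rfl
  let pr : MvPolynomial (Fin 2) ℂ →ₗ[ℂ] W := W.orthogonalProjectionOnto.toLinearMap ∘ₗ ι
  have hpr : ∀ (w : W) f, inner ℂ w (pr f) = inner ℂ (w : H) (ι f) := fun w f =>
    Submodule.inner_orthogonalProjectionOnto_eq_of_mem_left w (ι f)
  have hpre : ∀ f : degLT m, pr f = e f := fun f => ext_inner_left ℂ fun w => by
    rw [hpr, ← he, Submodule.coe_inner]
  have hprQ : ∀ k, pr (Q k) = 0 := fun k => ext_inner_left ℂ fun w => by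
    rw [hpr, inner_zero_right]
    obtain ⟨f, rfl⟩ := e.surjective w
    rw [he]
    exact horth k f f.2
  have hprspan : ∀ f ∈ Submodule.span ℂ (Set.range Q), pr f = 0 := by
    intro f hf
    have : Submodule.span ℂ (Set.range Q) ≤ LinearMap.ker pr := by
      rw [Submodule.span_le]
      rintro _ ⟨k, rfl⟩
      exact hprQ k
    exact this hf
  -- Multiplication by `X i` compressed to `W`. By `hadj` the two compressions are adjoint to each
  -- other.
  let T : Fin 2 → W →ₗ[ℂ] W := fun i =>
    pr ∘ₗ LinearMap.mulLeft ℂ (X i) ∘ₗ (degLT m).subtype ∘ₗ e.symm.toLinearMap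
  have hT : ∀ i (f : degLT m), T i (e f) = pr (X i * (f : MvPolynomial (Fin 2) ℂ)) :=
    fun i f => by simp [T]
  have hTadj : ∀ u v, inner ℂ (T 0 u) v = inner ℂ u (T 1 v) := by
    intro u v
    obtain ⟨f, rfl⟩ := e.surjective u
    obtain ⟨g, rfl⟩ := e.surjective v
    rw [hT, hT, hpr, ← inner_conj_symm, hpr, he, he, inner_conj_symm, hadj]
  have hTadj' : ∀ u v, inner ℂ (T 1 u) v = inner ℂ u (T 0 v) := by
    intro u v
    rw [← inner_conj_symm, ← hTadj, inner_conj_symm]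
  have hpr_mul : ∀ i f g, f - g ∈ Submodule.span ℂ (Set.range Q) → ∀ hg : g ∈ degLT m,
      T i (pr f) = pr (X i * g) := by
    intro i f g hfg hg
    have : pr f = e ⟨g, hg⟩ := by
      have h := hprspan _ hfg
      rw [map_sub, sub_eq_zero] at h
      rw [h]
      exact hpre ⟨g, hg⟩
    rw [this, hT]
  have hcomm : ∀ f ∈ degLT m, T 0 (pr (X 1 * f)) = T 1 (pr (X 0 * f)) := by
    refine degLT_induction ?_ (by simp) ?_ ?_
    · intro i j hij
      by_cases h : i + j + 1 < m
      · have h0 : X 0 * (X 0 ^ i * X 1 ^ j) ∈ degLT m := by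
          convert pow_mul_pow_mem_degLT (i := i + 1) (j := j) (m := m) (by omega) using 1
          ring
        have h1 : X 1 * (X 0 ^ i * X 1 ^ j) ∈ degLT m := by
          convert pow_mul_pow_mem_degLT (i := i) (j := j + 1) (m := m) (by omega) using 1
          ring
        rw [hpr_mul 0 _ _ (by simp) h1, hpr_mul 1 _ _ (by simp) h0]
        congr 1
        ring
      -- In top degree both products leave `degLT m`; modulo the `Q k`, which project to zero, each
      -- is replaced by its lower-degree remainder. The two results then differ by the syzygy.
      · obtain rfl : m = i + j + 1 := by omega
        let k : Fin (i + j + 1) := ⟨j, by omega⟩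
        have hl0 := hlead k.castSucc
        have hl1 := hlead k.succ
        have hQ : ∀ k', Q k' ∈ Submodule.span ℂ (Set.range Q) := fun k' =>
          Submodule.subset_span ⟨_, rfl⟩
        have e0 : X 0 * (X 0 ^ i * X 1 ^ j : MvPolynomial (Fin 2) ℂ)
            = X 0 ^ (i + j + 1 - (k.castSucc : ℕ)) * X 1 ^ (k.castSucc : ℕ) := by
          have : i + j + 1 - (k.castSucc : ℕ) = i + 1 := by simp [k]; omega
          rw [this, Fin.val_castSucc]; ring
        have e1 : X 1 * (X 0 ^ i * X 1 ^ j : MvPolynomial (Fin 2) ℂ)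
            = X 0 ^ (i + j + 1 - (k.succ : ℕ)) * X 1 ^ (k.succ : ℕ) := by
          have : i + j + 1 - (k.succ : ℕ) = i := by simp [k]
          rw [this, Fin.val_succ]; ring
        rw [← e0, ← neg_mem_iff, neg_sub] at hl0
        rw [← e1, ← neg_mem_iff, neg_sub] at hl1
        rw [hpr_mul 0 _ _ (by simpa using hQ _) hl1, hpr_mul 1 _ _ (by simpa using hQ _) hl0,
          ← sub_eq_zero, ← map_sub]
        refine hprspan _ ?_
        convert neg_mem (hsyz k) using 1
        ring
    · intro f g hf hg
      simp only [mul_add, map_add, hf, hg]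
    · intro r f hf
      simp only [mul_smul_comm, map_smul, hf]
  have hTcomm : T 0 * T 1 = T 1 * T 0 := by
    ext1 w
    obtain ⟨f, rfl⟩ := e.surjective w
    rw [Module.End.mul_apply, Module.End.mul_apply, hT, hT, hcomm f f.2]
  -- Up to a real factor, the self-adjoint real and imaginary parts of the normal operator `T 0`,
  -- which have a joint eigenspace decomposition.
  let A : W →ₗ[ℂ] W := T 0 + T 1
  let B : W →ₗ[ℂ] W := Complex.I • (T 0 - T 1)
  have hA : A.IsSymmetric := fun u v => by
    simp only [A, LinearMap.add_apply, inner_add_left, inner_add_right, hTadj, hTadj']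
    ring
  have hB : B.IsSymmetric := fun u v => by
    simp only [B, LinearMap.smul_apply, LinearMap.sub_apply, inner_smul_left, inner_smul_right,
      inner_sub_left, inner_sub_right, hTadj, hTadj', Complex.conj_I]
    ring
  have hAB : Commute A B := by
    have hc : Commute (T 0) (T 1) := hTcomm
    exact (((Commute.refl _).sub_right hc).add_left
      (hc.symm.sub_right (Commute.refl _))).smul_right _
  have htop := hA.iSup_iSup_eigenspace_inf_eigenspace_eq_top_of_commute hB hAB
  have hjoint : ∀ (α γ : ℂ) (w : W), w ∈ eigenspace A α ⊓ eigenspace B γ →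
      ∀ g ∈ degLT m, (∀ p ∈ commonZeros Q, IsRealPoint p → eval p g = 0) →
        inner ℂ (w : H) (ι g) = 0 := by
    rintro α γ w ⟨hwA, hwB⟩ g hg hgz
    by_cases hw0 : w = 0
    · simp [hw0]
    have hα : conj α = α := hA.conj_eigenvalue_eq_self
      (hasEigenvalue_of_hasEigenvector ⟨hwA, hw0⟩)
    have hγ : conj γ = γ := hB.conj_eigenvalue_eq_self
      (hasEigenvalue_of_hasEigenvector ⟨hwB, hw0⟩)
    have hwA : T 0 w + T 1 w = α • w := mem_eigenspace_iff.1 hwA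
    have hwB : Complex.I • (T 0 w - T 1 w) = γ • w := mem_eigenspace_iff.1 hwB
    set p : Fin 2 → ℂ := ![(α - Complex.I * γ) / 2, (α + Complex.I * γ) / 2] with hp
    have hp1 : p 1 = conj (p 0) := by
      have h2 : conj (2 : ℂ) = 2 := Complex.conj_ofNat 2
      simp [hp, hα, hγ, h2]
    have hwB' : T 0 w - T 1 w = (-Complex.I * γ) • w := by
      rw [mul_smul, ← hwB, smul_smul]; simp
    have hT0 : T 0 w = p 0 • w := by
      have : (2 : ℂ) • T 0 w = (α - Complex.I * γ) • w := by
        rw [sub_eq_add_neg, ← neg_mul, add_smul, ← hwA, ← hwB', two_smul]; abel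
      rw [show p 0 = (2 : ℂ)⁻¹ * (α - Complex.I * γ) by simp [hp]; ring, mul_smul, ← this,
        smul_smul]
      simp
    have hT1 : T 1 w = p 1 • w := by
      have : (2 : ℂ) • T 1 w = (α + Complex.I * γ) • w := by
        rw [← sub_neg_eq_add, ← neg_mul, sub_smul, ← hwA, ← hwB', two_smul]; abel
      rw [show p 1 = (2 : ℂ)⁻¹ * (α + Complex.I * γ) by simp [hp]; ring, mul_smul, ← this,
        smul_smul]
      simp
    have hmul : ∀ i, ∀ f ∈ degLT m,
        inner ℂ (w : H) (ι (X i * f)) = p i * inner ℂ (w : H) (ι f) := by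
      intro i f hf
      rw [← hpr, ← hT i ⟨f, hf⟩]
      have hef : inner ℂ (w : H) (ι f) = inner ℂ w (e ⟨f, hf⟩) := rfl
      rw [hef]
      fin_cases i
      · simp only [Fin.zero_eta, Fin.mk_zero]
        rw [← hTadj', hT1, inner_smul_left, hp1, Complex.conj_conj]
      · simp only [Fin.mk_one]
        rw [← hTadj, hT0, inner_smul_left, hp1]
    -- Pairing with a joint eigenvector is evaluation at `p` times a constant. It is essential that
    -- this reaches degree `m`: applied to `Q k`, it shows that `p` is a common zero unless the
    -- constant vanishes, in which case `w` is orthogonal to everything considered.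
    have heval : ∀ f ∈ degLT (m + 1),
        inner ℂ (w : H) (ι f) = eval p f * inner ℂ (w : H) (ι 1) := by
      refine degLT_induction ?_ (by simp) ?_ ?_
      · intro i
        induction i with
        | zero =>
          intro j
          induction j with
          | zero => intro _; simp
          | succ j ih =>
            intro hij
            have hmem := pow_mul_pow_mem_degLT (i := 0) (j := j) (m := m) (by omega)
            have h := hmul 1 _ hmem
            rw [ih (by omega)] at h
            rw [show (X 0 ^ 0 * X 1 ^ (j + 1) : MvPolynomial (Fin 2) ℂ)
              = X 1 * (X 0 ^ 0 * X 1 ^ j) by ring, h, map_mul (eval p) (X 1), eval_X, mul_assoc]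
        | succ i ih =>
          intro j hij
          have hmem := pow_mul_pow_mem_degLT (i := i) (j := j) (m := m) (by omega)
          have h := hmul 0 _ hmem
          rw [ih j (by omega)] at h
          rw [show (X 0 ^ (i + 1) * X 1 ^ j : MvPolynomial (Fin 2) ℂ)
            = X 0 * (X 0 ^ i * X 1 ^ j) by ring, h, map_mul (eval p) (X 0), eval_X, mul_assoc]
      · intro f g hf hg
        rw [map_add, inner_add_right, hf, hg, map_add, add_mul]
      · intro r f hf
        rw [map_smul, inner_smul_right, hf, smul_eval, mul_assoc]
    rw [heval g (degLT_mono (Nat.le_succ m) hg)]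
    by_cases h1 : inner ℂ (w : H) (ι 1) = 0
    · rw [h1, mul_zero]
    · rw [hgz p ?_ hp1, zero_mul]
      intro k
      have hQk : Q k ∈ degLT (m + 1) := by
        have h := add_mem (degLT_mono (Nat.le_succ m) (hlead k))
          (pow_mul_pow_mem_degLT (i := m - k) (j := k) (m := m + 1) (by omega))
        simpa using h
      have h := heval _ hQk
      rw [← hpr, hprQ, inner_zero_right, eq_comm, mul_eq_zero] at h
      exact h.resolve_right h1
  intro g hg hgz
  have hle : (⨆ α, ⨆ γ, eigenspace A α ⊓ eigenspace B γ) ≤ (ℂ ∙ e ⟨g, hg⟩)ᗮ := by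
    refine iSup_le fun α => iSup_le fun γ => fun w hw => ?_
    rw [Submodule.mem_orthogonal_singleton_iff_inner_left]
    exact hjoint α γ w hw g hg hgz
  rw [htop] at hle
  have hself := hle (Submodule.mem_top (x := e ⟨g, hg⟩))
  rw [Submodule.mem_orthogonal_singleton_iff_inner_left, inner_self_eq_zero,
    LinearEquiv.map_eq_zero_iff] at hself
  exact congrArg Subtype.val hself

end Spectral

/-! ### Minors of the band matrix through the roots of its symbol. -/

section BandMinors

lemma exists_sign_det_submatrix {α β : Type*} [Fintype α] [DecidableEq α] [Fintype β]
    [DecidableEq β] (e₁ e₂ : α ≃ β) :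
    ∃ ε : ℂ, ε ≠ 0 ∧ ∀ M : Matrix β β ℂ, (M.submatrix e₁ e₂).det = ε * M.det := by
  refine ⟨((Equiv.Perm.sign (e₂.symm.trans e₁) : ℤ) : ℂ), by simp, fun M => ?_⟩
  rw [← Matrix.det_permute, ← Matrix.det_submatrix_equiv_self e₂]
  congr 1
  ext i j
  simp

/-- The rows of the band matrix with diagonals `c`, `z₀`, `z₁`, `c'`. -/
def bandRow (c c' z₀ z₁ : ℂ) (i n : ℕ) : ℂ :=
  (if n = i then c else 0) + (if n = i + 1 then z₀ else 0) + (if n = i + 2 then z₁ else 0)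
    + (if n = i + 3 then c' else 0)

/-- The two boundary conditions encoding the perturbed entries `a'` and `a`, and the evaluation
of the coordinate `j + 1`. -/
def boundaryRow (a a' c c' : ℂ) (m j : ℕ) : Fin 3 → ℕ → ℂ :=
  ![fun n => (if n = 0 then c else 0) - (if n = 3 then a' - c' else 0),
    fun n => (if n = m + 2 then c' else 0) - (if n = m - 1 then a - c else 0),
    fun n => if n = j + 1 then 1 else 0]

/-- The band matrix with columns `0, …, m + 2` completed by the boundary rows. -/
def completedBand (a a' c c' z₀ z₁ : ℂ) (m j : ℕ) :
    Matrix (Fin m ⊕ Fin 3) (Fin m ⊕ Fin 3) ℂ :=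
  Matrix.fromBlocks (Matrix.of fun i n => bandRow c c' z₀ z₁ i n)
    (Matrix.of fun i n => bandRow c c' z₀ z₁ i (m + n))
    (Matrix.of fun s n => boundaryRow a a' c c' m j s n)
    (Matrix.of fun s n => boundaryRow a a' c c' m j s (m + n))

lemma sum_fin_add_sum_fin_three (m : ℕ) (f : ℕ → ℂ) :
    ∑ n : Fin m, f n + ∑ n : Fin 3, f (m + n) = ∑ n ∈ Finset.range (m + 3), f n := by
  rw [Finset.sum_range_add, Finset.sum_range, Finset.sum_range]

/-- Band rows annihilate the geometric sequences of the roots of the symbol. Multiplying by the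
matrix with these sequences as its last three columns leaves a block triangular product: a
triangular band block with diagonal `c`, and the boundary rows evaluated on the sequences. -/
lemma completedBand_det_mul (a a' c c' z₀ z₁ : ℂ) {m j : ℕ} (hm : 2 ≤ m) (hj : j ≤ m)
    (r : Fin 3 → ℂ) (hr : ∀ i, c + z₀ * r i + z₁ * r i ^ 2 + c' * r i ^ 3 = 0) :
    (completedBand a a' c c' z₀ z₁ m j).det
        * (Matrix.of fun (n i : Fin 3) => r i ^ (m + n : ℕ)).det
      = c ^ m * (Matrix.of ![fun i => c - (a' - c') * r i ^ 3,
          fun i => c' * r i ^ (m + 2) - (a - c) * r i ^ (m - 1), fun i => r i ^ (j + 1)]).det := by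
  let Y : Matrix (Fin m ⊕ Fin 3) (Fin m ⊕ Fin 3) ℂ :=
    Matrix.fromBlocks 1 (Matrix.of fun n i => r i ^ (n : ℕ)) 0
      (Matrix.of fun n i => r i ^ (m + n : ℕ))
  have hY : Y.det = (Matrix.of fun (n i : Fin 3) => r i ^ (m + n : ℕ)).det := by
    simp only [Y]
    rw [Matrix.det_fromBlocks_zero₂₁, Matrix.det_one, one_mul]
  rw [← hY, ← Matrix.det_mul, completedBand, Matrix.fromBlocks_multiply]
  have h12 : (Matrix.of fun (i n : Fin m) => bandRow c c' z₀ z₁ i n)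
        * (Matrix.of fun (n : Fin m) (i : Fin 3) => r i ^ (n : ℕ))
      + (Matrix.of fun (i : Fin m) (n : Fin 3) => bandRow c c' z₀ z₁ i (m + n))
        * (Matrix.of fun (n i : Fin 3) => r i ^ (m + n : ℕ)) = 0 := by
    ext i k
    simp only [Matrix.add_apply, Matrix.mul_apply, Matrix.of_apply, Matrix.zero_apply]
    rw [sum_fin_add_sum_fin_three m fun n => bandRow c c' z₀ z₁ i n * r k ^ n]
    have hi := i.2
    simp only [bandRow, add_mul, ite_mul, zero_mul, Finset.sum_add_distrib, Finset.sum_ite_eq',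
      Finset.mem_range]
    rw [if_pos (by omega), if_pos (by omega), if_pos (by omega), if_pos (by omega)]
    linear_combination r k ^ (i : ℕ) * hr k
  have h22 : (Matrix.of fun (s : Fin 3) (n : Fin m) => boundaryRow a a' c c' m j s n)
        * (Matrix.of fun (n : Fin m) (i : Fin 3) => r i ^ (n : ℕ))
      + (Matrix.of fun (s n : Fin 3) => boundaryRow a a' c c' m j s (m + n))
        * (Matrix.of fun (n i : Fin 3) => r i ^ (m + n : ℕ))
      = Matrix.of ![fun i => c - (a' - c') * r i ^ 3,
          fun i => c' * r i ^ (m + 2) - (a - c) * r i ^ (m - 1), fun i => r i ^ (j + 1)] := by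
    ext s k
    simp only [Matrix.add_apply, Matrix.mul_apply, Matrix.of_apply]
    rw [sum_fin_add_sum_fin_three m fun n => boundaryRow a a' c c' m j s n * r k ^ n]
    fin_cases s <;>
      simp [boundaryRow, sub_mul, ite_mul, Finset.sum_sub_distrib, Finset.sum_ite_eq'] <;> omega
  rw [h12, h22, Matrix.mul_one, Matrix.mul_zero, add_zero, Matrix.det_fromBlocks_zero₁₂]
  congr 1
  rw [Matrix.det_of_isUpperTriangular]
  · rw [Finset.prod_congr rfl (g := fun _ => c), Finset.prod_const, Finset.card_univ,
      Fintype.card_fin]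
    intro i _
    simp [bandRow]
  · intro i k hik
    have hik : (k : ℕ) < i := hik
    simp only [Matrix.of_apply, bandRow]
    rw [if_neg (by omega), if_neg (by omega), if_neg (by omega), if_neg (by omega)]
    simp

/-- The numerical value of the matrix `A(z₀, z₁)` with the entries `a`, `a'`, `c`, `c'`. -/
def bandMatrix (a a' c c' z₀ z₁ : ℂ) (m : ℕ) : Matrix (Fin m) (Fin (m + 1)) ℂ :=
  Matrix.of fun i j =>
    (if (j : ℕ) = i + 2 then (if (i : ℕ) = 0 then a' else c')
      else if (i : ℕ) = j + 1 then (if (i : ℕ) + 1 = m then a else c) else 0)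
    + z₀ * (if (i : ℕ) = j then 1 else 0) + z₁ * (if 1 + (i : ℕ) = j then 1 else 0)

/-- Subtracting the two boundary conditions from the first and last band rows clears the columns `0`
and `m + 2` and creates the perturbed entries `a'` and `a`. What remains in the top block is
`bandMatrix`, shifted by one column, with a unit row whose expansion removes column `j`. -/
lemma exists_completedBand_det (m : ℕ) (hm : 2 ≤ m) (j : Fin (m + 1)) :
    ∃ ε : ℂ, ε ≠ 0 ∧ ∀ a a' c c' z₀ z₁ : ℂ,
      ε * (completedBand a a' c c' z₀ z₁ m j).det
        = c * c' * ((bandMatrix a a' c c' z₀ z₁ m).submatrix id j.succAbove).det := by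
  -- The reordering moves the unit row just below the band rows, and the two outer columns to the
  -- end.
  let ρ₀ : Fin (m + 1) ⊕ Fin 2 → Fin m ⊕ Fin 3 := Sum.elim
    (Fin.lastCases (Sum.inr 2) (fun i => Sum.inl i)) (fun s => Sum.inr s.castSucc)
  let κ₀ : Fin (m + 1) ⊕ Fin 2 → Fin (m + 3) := Sum.elim
    (fun i => ⟨i + 1, by omega⟩) ![⟨0, by omega⟩, ⟨m + 2, by omega⟩]
  have hρ : Function.Bijective ρ₀ := by
    rw [Fintype.bijective_iff_injective_and_card]
    refine ⟨?_, by simp⟩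
    rintro (i | i) (k | k) h
    · induction i using Fin.lastCases <;> induction k using Fin.lastCases <;> simp_all [ρ₀]
    · induction i using Fin.lastCases <;> fin_cases k <;> simp_all [ρ₀]
    · induction k using Fin.lastCases <;> fin_cases i <;> simp_all [ρ₀]
    · simp_all [ρ₀]
  have hκ : Function.Bijective κ₀ := by
    rw [Fintype.bijective_iff_injective_and_card]
    refine ⟨?_, by simp⟩
    rintro (i | i) (k | k) h
    · simp only [κ₀, Sum.elim_inl, Fin.mk.injEq] at h
      exact congrArg Sum.inl (Fin.ext (by omega))
    · have := i.2
      fin_cases k <;> simp [κ₀] at h <;> omega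
    · have := k.2
      fin_cases i <;> simp [κ₀] at h <;> omega
    · fin_cases i <;> fin_cases k <;> simp [κ₀] at h <;> rfl
  obtain ⟨ε, hε, hdet⟩ := exists_sign_det_submatrix (Equiv.ofBijective ρ₀ hρ)
    ((Equiv.ofBijective κ₀ hκ).trans finSumFinEquiv.symm)
  refine ⟨(-1) ^ (m + j : ℕ) * ε, by simp [hε], fun a a' c c' z₀ z₁ => ?_⟩
  let G : Matrix (Fin m) (Fin 3) ℂ := Matrix.of fun i s =>
    if s = 0 ∧ (i : ℕ) = 0 ∨ s = 1 ∧ (i : ℕ) + 1 = m then -1 else 0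
  have hrow : (completedBand a a' c c' z₀ z₁ m j).det
      = (Matrix.fromBlocks 1 G 0 1 * completedBand a a' c c' z₀ z₁ m j).det := by
    rw [Matrix.det_mul, Matrix.det_fromBlocks_zero₂₁]
    simp
  set E' := Matrix.fromBlocks 1 G 0 1 * completedBand a a' c c' z₀ z₁ m j with hE'
  have hE'l : ∀ i n, E' (Sum.inl i) (finSumFinEquiv.symm n) = bandRow c c' z₀ z₁ i n
      - (if (i : ℕ) = 0 then (if (n : ℕ) = 0 then c else 0) - (if (n : ℕ) = 3 then a' - c' else 0)
        else 0)
      - (if (i : ℕ) + 1 = m then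
          (if (n : ℕ) = m + 2 then c' else 0) - (if (n : ℕ) = m - 1 then a - c else 0)
        else 0) := by
    intro i n
    have h : E' (Sum.inl i) (finSumFinEquiv.symm n)
        = bandRow c c' z₀ z₁ i n + ∑ s, G i s * boundaryRow a a' c c' m j s n := by
      rw [hE', completedBand, Matrix.fromBlocks_multiply]
      induction n using Fin.addCases <;> simp [Matrix.mul_apply]
    rw [h, Fin.sum_univ_three]
    have h0 : G i 0 = if (i : ℕ) = 0 then -1 else 0 := by simp [G]
    have h1 : G i 1 = if (i : ℕ) + 1 = m then -1 else 0 := by simp [G]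
    have h2 : G i 2 = 0 := by simp [G]
    rw [h0, h1, h2]
    simp only [boundaryRow, Matrix.cons_val_zero, Matrix.cons_val_one, zero_mul, ite_mul]
    split_ifs <;> ring
  have hE'r : ∀ s n, E' (Sum.inr s) (finSumFinEquiv.symm n) = boundaryRow a a' c c' m j s n := by
    intro i n
    rw [hE', completedBand, Matrix.fromBlocks_multiply]
    induction n using Fin.addCases <;> simp
  obtain ⟨TL, hTl, hTc⟩ : ∃ TL : Matrix (Fin (m + 1)) (Fin (m + 1)) ℂ,
      (∀ k, TL (Fin.last m) k = if k = j then 1 else 0) ∧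
      ∀ i k, TL (Fin.castSucc i) k = bandMatrix a a' c c' z₀ z₁ m i k :=
    ⟨Matrix.of fun i k => if h : (i : ℕ) < m then bandMatrix a a' c c' z₀ z₁ m ⟨i, h⟩ k
      else if k = j then 1 else 0, fun k => by simp, fun i k => by simp⟩
  have hblock : E'.submatrix (Equiv.ofBijective ρ₀ hρ)
        ((Equiv.ofBijective κ₀ hκ).trans finSumFinEquiv.symm)
      = Matrix.fromBlocks
        TL 0
        (Matrix.of fun s k => boundaryRow a a' c c' m j s.castSucc (k + 1))
        (Matrix.diagonal ![c, c']) := by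
    have hkl : ∀ k : Fin (m + 1), (κ₀ (Sum.inl k) : ℕ) = k + 1 := fun k => rfl
    have hkr : ∀ t : Fin 2, (κ₀ (Sum.inr t) : ℕ) = if t = 0 then 0 else m + 2 := by
      intro t; fin_cases t <;> rfl
    ext (i | s) (k | t)
    · rw [Matrix.submatrix_apply, Equiv.ofBijective_apply, Equiv.trans_apply,
        Equiv.ofBijective_apply, Matrix.fromBlocks_apply₁₁]
      induction i using Fin.lastCases with
      | last =>
        rw [show ρ₀ (Sum.inl (Fin.last m)) = Sum.inr 2 by simp [ρ₀], hE'r, hkl, hTl]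
        change (if (k : ℕ) + 1 = j + 1 then (1 : ℂ) else 0) = _
        simp only [Fin.ext_iff, Nat.add_right_cancel_iff]
      | cast i =>
        rw [show ρ₀ (Sum.inl i.castSucc) = Sum.inl i by simp [ρ₀], hE'l, hkl, hTc]
        have := i.2
        have := k.2
        simp only [bandRow, bandMatrix, Matrix.of_apply]
        grind
    · rw [Matrix.submatrix_apply, Equiv.ofBijective_apply, Equiv.trans_apply,
        Equiv.ofBijective_apply, Matrix.fromBlocks_apply₁₂, Matrix.zero_apply]
      induction i using Fin.lastCases with
      | last =>
        rw [show ρ₀ (Sum.inl (Fin.last m)) = Sum.inr 2 by simp [ρ₀], hE'r, hkr]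
        have := j.2
        change (if _ = (j : ℕ) + 1 then (1 : ℂ) else 0) = _
        refine if_neg ?_
        fin_cases t <;> simp
        omega
      | cast i =>
        rw [show ρ₀ (Sum.inl i.castSucc) = Sum.inl i by simp [ρ₀], hE'l, hkr]
        have := i.2
        simp only [bandRow]
        grind
    · rw [Matrix.submatrix_apply, Equiv.ofBijective_apply, Equiv.trans_apply,
        Equiv.ofBijective_apply, Matrix.fromBlocks_apply₂₁,
        show ρ₀ (Sum.inr s) = Sum.inr s.castSucc by simp [ρ₀], hE'r, hkl]
      rfl
    · rw [Matrix.submatrix_apply, Equiv.ofBijective_apply, Equiv.trans_apply,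
        Equiv.ofBijective_apply, Matrix.fromBlocks_apply₂₂,
        show ρ₀ (Sum.inr s) = Sum.inr s.castSucc by simp [ρ₀], hE'r, hkr]
      fin_cases s <;> fin_cases t <;> simp [boundaryRow] <;> omega
  rw [hrow, mul_assoc, ← hdet, hblock, Matrix.det_fromBlocks_zero₁₂, Matrix.det_diagonal,
    Matrix.det_succ_row _ (Fin.last m)]
  have hsub : TL.submatrix (Fin.last m).succAbove j.succAbove
      = (bandMatrix a a' c c' z₀ z₁ m).submatrix id j.succAbove := by
    ext i k
    simp [hTc]
  simp only [hTl, mul_ite, mul_one, mul_zero, ite_mul, zero_mul,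
    Finset.sum_ite_eq', Finset.mem_univ, if_true, Fin.val_last,
    Fin.prod_univ_two, Matrix.cons_val_zero, Matrix.cons_val_one]
  rw [hsub]
  have hsq : ((-1 : ℂ) ^ (m + j : ℕ)) * (-1) ^ (m + j : ℕ) = 1 := by
    rw [← mul_pow]; simp
  linear_combination (c * c' * ((bandMatrix a a' c c' z₀ z₁ m).submatrix id j.succAbove).det) * hsq

end BandMinors

/-! ### The alternant formula on the deltoid. -/

section TorusFormula

/-- The point `(z₀, z₁)` parametrized by the elementary symmetric functions of `t`. -/
def deltoid (κ : ℂ) (t : Fin 3 → ℂ) : Fin 2 → ℂ :=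
  ![κ * (t 0 * t 1 + t 0 * t 2 + t 1 * t 2), conj κ * (t 0 + t 1 + t 2)]

/-- The Vandermonde determinant of `t`. -/
def vand (t : Fin 3 → ℂ) : ℂ := (t 1 - t 0) * (t 2 - t 0) * (t 2 - t 1)

/-- The alternating numerator of `Q_k^m` on the deltoid, with `j = m - k`. -/
def alternant (b : ℂ) (m j : ℕ) (t : Fin 3 → ℂ) : Matrix (Fin 3) (Fin 3) ℂ :=
  Matrix.of ![fun i => 1 + conj b * t i ^ 3, fun i => t i ^ (m + 2) + b * t i ^ (m - 1),
    fun i => t i ^ (j + 1)]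

lemma eval_Q (a c : ℂ) (m : ℕ) (k : Fin (m + 1)) (p : Fin 2 → ℂ) :
    eval p (Q a c m k)
      = ((bandMatrix a (conj a) c (conj c) (p 0) (p 1) m).submatrix id k.rev.succAbove).det := by
  rw [Q, charPoly, RingHom.map_det, RingHom.mapMatrix_apply, ← Matrix.submatrix_map]
  congr 2
  ext i j
  simp only [shifted, perturbedToeplitz, bandMatrix, unitMatrix, Matrix.map_apply,
    Matrix.add_apply, Matrix.smul_apply, Matrix.of_apply, smul_eq_mul, map_add, map_mul, eval_X,
    eval_C, zero_add]
  congr 2 <;> split_ifs <;> simp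

/-- At a point of the deltoid the symbol has the roots `ω * t i`. Their Vandermonde-type determinant
is a power of `ω` times `vand t`, because `t 0 * t 1 * t 2 = 1`, and the boundary rows become
multiples of the rows of the alternant. -/
theorem exists_eval_Q_mul_vand {a b c κ : ℂ} (hκ : κ ≠ 0) (hκc : κ ^ 2 = c * conj κ)
    (hab : a = c * (1 + b)) {m : ℕ} (hm : 2 ≤ m) (k : Fin (m + 1)) :
    ∃ C : ℂ, ∀ t : Fin 3 → ℂ, t 0 * t 1 * t 2 = 1 →
      eval (deltoid κ t) (Q a c m k) * vand t = C * (alternant b m (m - k) t).det := by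
  obtain ⟨ε, hε, h⟩ := exists_completedBand_det m hm k.rev
  have hκ' : conj κ ≠ 0 := by simpa using hκ
  set κ' := conj κ with hκ'def
  have hc : c = κ ^ 2 / κ' := by field_simp; exact hκc.symm
  have hc' : conj c = κ' ^ 2 / κ := by
    rw [hc, map_div₀, map_pow, hκ'def, Complex.conj_conj]
  set c' := conj c with hc'def
  have hc0 : c ≠ 0 := by rw [hc]; positivity
  have hc'0 : c' ≠ 0 := by rw [hc']; positivity
  have ha' : conj a = c' * (1 + conj b) := by rw [hab]; simp [hc'def]
  -- Chosen so that `κ ω = -c`, `κ' ω² = c` and `c' ω³ = -c`, which turns the symbol into `c` times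
  -- the cubic `∏ (1 - s / t i)`, in the variable `s` with `r = ω s`.
  set ω : ℂ := -(κ / κ') with hω
  have hω0 : ω ≠ 0 := by simp [hω, hκ, hκ']
  have hω3 : c' * ω ^ 3 = -c := by
    rw [hc, hc', hω]; field_simp
  have hkrev : (k.rev : ℕ) = m - k := by rw [Fin.val_rev]; omega
  refine ⟨ε * c ^ m * (c * (ω ^ (m + 2) * c') * ω ^ (m - k + 1)) / (c * c' * ω ^ (3 * m + 3)),
    fun t ht => ?_⟩
  have hroot : ∀ i, c + κ * (t 0 * t 1 + t 0 * t 2 + t 1 * t 2) * (ω * t i)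
      + κ' * (t 0 + t 1 + t 2) * (ω * t i) ^ 2 + c' * (ω * t i) ^ 3 = 0 := by
    intro i
    have hcub : 1 - (t 0 * t 1 + t 0 * t 2 + t 1 * t 2) * t i + (t 0 + t 1 + t 2) * t i ^ 2
        - t i ^ 3 = 0 := by
      rw [← ht]
      fin_cases i <;> simp <;> ring
    have h1 : κ * ω = -c := by rw [hω, hc]; field_simp
    have h2 : κ' * ω ^ 2 = c := by rw [hω, hc]; field_simp
    linear_combination c * hcub + (t 0 * t 1 + t 0 * t 2 + t 1 * t 2) * t i * h1
      + (t 0 + t 1 + t 2) * t i ^ 2 * h2 + t i ^ 3 * hω3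
  have h1 := completedBand_det_mul a (conj a) c c' _ _ hm (Nat.lt_succ_iff.1 k.rev.2) _ hroot
  have h2 := h a (conj a) c c' (deltoid κ t 0) (deltoid κ t 1)
  rw [← eval_Q] at h2
  have hK : (Matrix.of fun (n i : Fin 3) => (ω * t i) ^ (m + n : ℕ)).det
      = ω ^ (3 * m + 3) * vand t := by
    have htm : t 0 ^ m * t 1 ^ m * t 2 ^ m = 1 := by rw [← mul_pow, ← mul_pow, ht, one_pow]
    rw [Matrix.det_fin_three]
    simp only [Matrix.of_apply, Fin.val_zero, Fin.val_one, Fin.val_two, vand]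
    linear_combination (ω ^ (3 * m + 3) * ((t 1 - t 0) * (t 2 - t 0) * (t 2 - t 1))) * htm
  have hΛ : (Matrix.of ![fun i => c - (conj a - c') * (ω * t i) ^ 3,
        fun i => c' * (ω * t i) ^ (m + 2) - (a - c) * (ω * t i) ^ (m - 1),
        fun i => (ω * t i) ^ ((k.rev : ℕ) + 1)]).det
      = c * (ω ^ (m + 2) * c') * ω ^ (m - k + 1) * (alternant b m (m - k) t).det := by
    have : Matrix.of ![fun i => c - (conj a - c') * (ω * t i) ^ 3,
        fun i => c' * (ω * t i) ^ (m + 2) - (a - c) * (ω * t i) ^ (m - 1),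
        fun i => (ω * t i) ^ ((k.rev : ℕ) + 1)]
        = Matrix.of fun s i => ![c, ω ^ (m + 2) * c', ω ^ (m - k + 1)] s
          * alternant b m (m - k) t s i := by
      obtain ⟨n, rfl⟩ : ∃ n, m = n + 1 := ⟨m - 1, by omega⟩
      ext s i
      fin_cases s
      · simp only [alternant, ha', Matrix.of_apply, Fin.zero_eta, Matrix.cons_val_zero]
        linear_combination (-conj b * t i ^ 3) * hω3
      · simp only [alternant, hab, Matrix.of_apply, Fin.mk_one, Matrix.cons_val_one,
          Matrix.cons_val_zero, Nat.add_sub_cancel]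
        linear_combination (-b * ω ^ n * t i ^ n) * hω3
      · simp only [alternant, hkrev, Matrix.of_apply, Fin.reduceFinMk, Matrix.cons_val]
        ring
    rw [this, Matrix.det_mul_column, Fin.prod_univ_three]
    rfl
  rw [hK, hΛ] at h1
  have hden : c * c' * ω ^ (3 * m + 3) ≠ 0 := by positivity
  rw [div_mul_eq_mul_div, eq_div_iff hden]
  have e1 : deltoid κ t 0 = κ * (t 0 * t 1 + t 0 * t 2 + t 1 * t 2) := rfl
  have e2 : deltoid κ t 1 = κ' * (t 0 + t 1 + t 2) := rfl
  rw [e1, e2] at h2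
  linear_combination (-ω ^ (3 * m + 3) * vand t) * h2 + ε * h1

end TorusFormula

/-! ### The torus of `SU(3)`, its rotations and Cauchy's theorem. -/

section Torus

open MeasureTheory

noncomputable instance : MeasurableSpace (Circle × Circle) := borel _

instance : BorelSpace (Circle × Circle) := ⟨rfl⟩

/-- The maximal torus of `SU(3)`, as triples of complex numbers. -/
noncomputable def torusPt (x : Circle × Circle) : Fin 3 → ℂ :=
  ![x.1, x.2, ((x.1 * x.2)⁻¹ : Circle)]

lemma norm_torusPt (x : Circle × Circle) (i : Fin 3) : ‖torusPt x i‖ = 1 := by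
  fin_cases i <;> simp [torusPt, Circle.norm_coe]

lemma torusPt_ne_zero (x : Circle × Circle) (i : Fin 3) : torusPt x i ≠ 0 := by
  rw [← norm_ne_zero_iff, norm_torusPt]; exact one_ne_zero

lemma conj_torusPt (x : Circle × Circle) (i : Fin 3) : conj (torusPt x i) = (torusPt x i)⁻¹ := by
  rw [Complex.inv_eq_conj (norm_torusPt x i)]

lemma torusPt_prod (x : Circle × Circle) : torusPt x 0 * torusPt x 1 * torusPt x 2 = 1 := by
  simp only [torusPt, Matrix.cons_val]
  rw [← Circle.coe_mul, ← Circle.coe_mul, mul_inv_cancel, Circle.coe_one]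

@[fun_prop]
lemma continuous_torusPt : Continuous torusPt := by
  refine continuous_pi fun i => ?_
  fin_cases i <;> simp only [torusPt, Fin.zero_eta, Fin.mk_one, Fin.reduceFinMk, Matrix.cons_val]
    <;> fun_prop

/-- The exponents `-1, 1, 0` have sum zero, so in any order they define a one-parameter subgroup of
the torus. -/
lemma exists_rotation (σ : Equiv.Perm (Fin 3)) :
    ∃ g : Circle → Circle × Circle, Continuous g ∧ ∀ s x,
      torusPt (g s * x) ∘ σ = ![(s : ℂ)⁻¹ * torusPt x (σ 0), s * torusPt x (σ 1),
        torusPt x (σ 2)] := by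
  set k : Fin 3 → ℤ := ![-1, 1, 0] ∘ σ.symm with hk
  have hsum : k 0 + k 1 + k 2 = 0 := by
    rw [← Fin.sum_univ_three, hk]
    exact (Equiv.sum_comp σ.symm (![-1, 1, 0] : Fin 3 → ℤ)).trans (by simp [Fin.sum_univ_three])
  have hrot : ∀ (s : Circle) x i,
      torusPt (((s ^ k 0, s ^ k 1) : Circle × Circle) * x) i = (s : ℂ) ^ k i * torusPt x i := by
    intro s x i
    have h2 : k 2 = -(k 0 + k 1) := by omega
    fin_cases i
    · simp [torusPt]
    · simp [torusPt]
    · have : ((s ^ k 0 * x.1) * (s ^ k 1 * x.2))⁻¹ = s ^ k 2 * (x.1 * x.2)⁻¹ := by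
        rw [h2, zpow_neg, ← mul_inv, zpow_add]
        congr 1
        exact mul_mul_mul_comm _ _ _ _
      simp only [torusPt, Fin.reduceFinMk, Matrix.cons_val, Prod.fst_mul, Prod.snd_mul]
      rw [this, Circle.coe_mul, Circle.coe_zpow]
  refine ⟨fun s => (s ^ k 0, s ^ k 1), by fun_prop, fun s x => ?_⟩
  ext i
  rw [Function.comp_apply, hrot]
  fin_cases i <;> simp [hk]

/-- Averaging over a one-parameter rotation of the torus. -/
lemma integral_eq_zero_of_rotation {F : Circle × Circle → ℂ} (hF : Continuous F)
    {g : Circle → Circle × Circle} (hg : Continuous g)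
    (h : ∀ x, ∫ θ in (0 : ℝ)..2 * Real.pi, F (g (Circle.exp θ) * x) = 0) :
    ∫ x, F x ∂(Measure.haar : Measure (Circle × Circle)) = 0 := by
  set μ : Measure (Circle × Circle) := Measure.haar
  obtain ⟨B, hB⟩ : ∃ B, ∀ x, ‖F x‖ ≤ B := by
    obtain ⟨B, hB⟩ := isCompact_univ.exists_bound_of_continuousOn hF.continuousOn
    exact ⟨B, fun x => hB x (Set.mem_univ x)⟩
  have hcont : Continuous fun q : ℝ × (Circle × Circle) => F (g (Circle.exp q.1) * q.2) := by
    fun_prop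
  have hint : Integrable (Function.uncurry fun (θ : ℝ) x => F (g (Circle.exp θ) * x))
      ((volume.restrict (Set.Ioc 0 (2 * Real.pi))).prod μ) :=
    Integrable.of_bound hcont.aestronglyMeasurable B (Filter.Eventually.of_forall fun q => hB _)
  -- By translation invariance the swapped double integral is `2π` times the integral of `F`.
  have hswap := integral_integral_swap hint
  have hpi : (0 : ℝ) ≤ 2 * Real.pi := by positivity
  simp only [← intervalIntegral.integral_of_le hpi, h, integral_zero,
    integral_mul_left_eq_self F, intervalIntegral.integral_const] at hswap
  simpa [Real.pi_ne_zero] using hswap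

/-- Cauchy's theorem for `s * Φ s` on the unit circle. -/
lemma integral_exp_mul_eq_zero {Φ : ℂ → ℂ} (hΦ : DifferentiableOn ℂ Φ (Metric.closedBall 0 1)) :
    ∫ θ in (0 : ℝ)..2 * Real.pi, (Circle.exp θ : ℂ) * Φ (Circle.exp θ) = 0 := by
  have hd : DiffContOnCl ℂ Φ (Metric.ball 0 1) := by
    refine DifferentiableOn.diffContOnCl ?_
    rwa [closure_ball (0 : ℂ) one_ne_zero]
  have h := hd.circleIntegral_eq_zero zero_le_one
  rw [circleIntegral] at h
  simp only [deriv_circleMap, circleMap, Complex.ofReal_one, one_mul, zero_add, smul_eq_mul] at h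
  have h' : (∫ θ in (0 : ℝ)..2 * Real.pi, (Circle.exp θ : ℂ) * Φ (Circle.exp θ)) * Complex.I
      = 0 := by
    rw [← intervalIntegral.integral_mul_const, ← h]
    congr 1
    ext θ
    rw [Circle.coe_exp]
    ring
  exact (mul_eq_zero.1 h').resolve_right Complex.I_ne_zero

end Torus

/-! ### Polynomials are determined by their values on the deltoid. -/

section Density

lemma exists_deltoid_clear_denominators (κ : ℂ) (f : MvPolynomial (Fin 2) ℂ) :
    ∃ (d : ℕ) (F : MvPolynomial (Fin 2) ℂ), ∀ x y : ℂ, x ≠ 0 → y ≠ 0 →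
      eval ![x, y] F = (x * y) ^ d * eval (deltoid κ ![x, y, (x * y)⁻¹]) f := by
  induction f using MvPolynomial.induction_on with
  | C r => exact ⟨0, C r, by simp⟩
  | add f g hf hg =>
    obtain ⟨d, F, hF⟩ := hf
    obtain ⟨e, G, hG⟩ := hg
    refine ⟨d + e, F * (X 0 * X 1) ^ e + G * (X 0 * X 1) ^ d, fun x y hx hy => ?_⟩
    simp only [map_add, map_mul, map_pow, eval_X, hF x y hx hy, hG x y hx hy, Matrix.cons_val_zero,
      Matrix.cons_val_one]
    ring
  | mul_X f i hf =>
    obtain ⟨d, F, hF⟩ := hf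
    refine ⟨d + 1, F * ![C κ * (X 0 ^ 2 * X 1 ^ 2 + X 0 + X 1),
      C (conj κ) * (X 0 ^ 2 * X 1 + X 0 * X 1 ^ 2 + 1)] i, fun x y hx hy => ?_⟩
    fin_cases i <;>
      simp [hF x y hx hy, deltoid] <;> field_simp <;> ring

/-- The coordinates of `p` prescribe `e₁` and `e₂`; the required triple consists of the roots of `X³
- e₁ X² + e₂ X - 1`. -/
lemma exists_deltoid_eq {κ : ℂ} (hκ : κ ≠ 0) (p : Fin 2 → ℂ) :
    ∃ x y : ℂ, x ≠ 0 ∧ y ≠ 0 ∧ deltoid κ ![x, y, (x * y)⁻¹] = p := by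
  have hκ' : conj κ ≠ 0 := by simpa using hκ
  set e₁ := p 1 / conj κ with he₁
  set e₂ := p 0 / κ with he₂
  obtain ⟨x, hx⟩ : ∃ x : ℂ, x ^ 3 - e₁ * x ^ 2 + e₂ * x - 1 = 0 := by
    have hdeg : (Polynomial.X ^ 3 + (Polynomial.C (-e₁) * Polynomial.X ^ 2
        + Polynomial.C e₂ * Polynomial.X + Polynomial.C (-1)) : Polynomial ℂ).degree = 3 := by
      compute_degree!
    obtain ⟨x, hx⟩ := IsAlgClosed.exists_root _ (by rw [hdeg]; norm_num)
    refine ⟨x, ?_⟩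
    simp only [Polynomial.IsRoot, Polynomial.eval_add, Polynomial.eval_mul, Polynomial.eval_pow,
      Polynomial.eval_X, Polynomial.eval_C] at hx
    linear_combination hx
  have hx0 : x ≠ 0 := by
    rintro rfl
    norm_num at hx
  obtain ⟨y, hy⟩ : ∃ y : ℂ, y ^ 2 + (x - e₁) * y + x⁻¹ = 0 := by
    have hdeg : (Polynomial.X ^ 2 + (Polynomial.C (x - e₁) * Polynomial.X
        + Polynomial.C x⁻¹) : Polynomial ℂ).degree = 2 := by
      compute_degree!
    obtain ⟨y, hy⟩ := IsAlgClosed.exists_root _ (by rw [hdeg]; norm_num)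
    refine ⟨y, ?_⟩
    simp only [Polynomial.IsRoot, Polynomial.eval_add, Polynomial.eval_mul, Polynomial.eval_pow,
      Polynomial.eval_X, Polynomial.eval_C] at hy
    linear_combination hy
  have hy0 : y ≠ 0 := by
    rintro rfl
    simp [hx0] at hy
  have hw : (x * y)⁻¹ = e₁ - x - y := by
    field_simp
    field_simp at hy
    linear_combination hy
  have hxy : x * y * (e₁ - x - y) = 1 := by
    rw [← hw, mul_inv_cancel₀ (mul_ne_zero hx0 hy0)]
  refine ⟨x, y, hx0, hy0, ?_⟩
  rw [hw]
  ext i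
  fin_cases i
  · simp only [deltoid, Fin.zero_eta, Matrix.cons_val]
    have : x * y + x * (e₁ - x - y) + y * (e₁ - x - y) = e₂ := by
      apply mul_left_cancel₀ hx0
      linear_combination -hx + hxy
    rw [this, he₂]
    field_simp
  · simp only [deltoid, Fin.mk_one, Matrix.cons_val]
    rw [show x + y + (e₁ - x - y) = e₁ by ring, he₁]
    field_simp

lemma infinite_circle : {z : ℂ | ‖z‖ = 1}.Infinite := by
  have : Infinite Circle := by
    have : Infinite (Set.Ioc (-Real.pi) Real.pi) :=
      (Set.Ioc_infinite (by linarith [Real.pi_pos])).to_subtype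
    exact Infinite.of_injective _ Circle.argEquiv.symm.injective
  exact Set.infinite_of_injective_forall_mem (f := fun x : Circle => (x : ℂ))
    Circle.coe_injective fun x => Circle.norm_coe x

/-- A polynomial vanishing at the regular points of the deltoid is zero. -/
theorem eq_zero_of_eval_deltoid {κ : ℂ} (hκ : κ ≠ 0) {f : MvPolynomial (Fin 2) ℂ}
    (h : ∀ x, eval (deltoid κ (torusPt x)) f * vand (torusPt x) = 0) : f = 0 := by
  obtain ⟨d, F, hF⟩ := exists_deltoid_clear_denominators κ f
  -- The Vandermonde determinant of `(x, y, (xy)⁻¹)` multiplied by `(xy)²`.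
  set V : MvPolynomial (Fin 2) ℂ := (X 1 - X 0) * (1 - X 0 ^ 2 * X 1) * (1 - X 0 * X 1 ^ 2) with hV
  have hV0 : V ≠ 0 := by
    intro h0
    have := congrArg (eval ![2, 3]) h0
    simp [hV] at this
    norm_num at this
  -- A product of infinite sets is Zariski dense, so vanishing for `x` and `y` on the unit circle is
  -- enough.
  have hFV : F * V = 0 := by
    refine funext_set (fun _ => {z : ℂ | ‖z‖ = 1}) (fun _ => infinite_circle) fun q hq => ?_
    have h0 : ‖q 0‖ = 1 := hq 0 (Set.mem_univ _)
    have h1 : ‖q 1‖ = 1 := hq 1 (Set.mem_univ _)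
    have hq0 : q 0 ≠ 0 := by rw [← norm_ne_zero_iff, h0]; exact one_ne_zero
    have hq1 : q 1 ≠ 0 := by rw [← norm_ne_zero_iff, h1]; exact one_ne_zero
    have hqq : q = ![q 0, q 1] := by ext i; fin_cases i <;> rfl
    let u : Circle := ⟨q 0, mem_sphere_zero_iff_norm.2 h0⟩
    let v : Circle := ⟨q 1, mem_sphere_zero_iff_norm.2 h1⟩
    have ht : torusPt (u, v) = ![q 0, q 1, (q 0 * q 1)⁻¹] := by
      rw [torusPt, Circle.coe_inv, Circle.coe_mul]
    have hz := h (u, v)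
    rw [ht] at hz
    have hv : eval q V = (q 0 * q 1) ^ 2 * vand ![q 0, q 1, (q 0 * q 1)⁻¹] := by
      simp only [hV, vand, map_mul, map_sub, map_one, map_pow, eval_X, Matrix.cons_val]
      field_simp
    rw [map_mul, hv, map_zero]
    rw [hqq, hF _ _ hq0 hq1]
    simp only [Matrix.cons_val_zero, Matrix.cons_val_one]
    linear_combination ((q 0 * q 1) ^ d * (q 0 * q 1) ^ 2) * hz
  have hF0 : F = 0 := (mul_eq_zero.1 hFV).resolve_right hV0
  refine MvPolynomial.funext fun p => ?_
  obtain ⟨x, y, hx, hy, rfl⟩ := exists_deltoid_eq hκ p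
  have h1 := hF x y hx hy
  rw [hF0, map_zero, eq_comm, mul_eq_zero] at h1
  rw [h1.resolve_left (pow_ne_zero _ (mul_ne_zero hx hy)), map_zero]

end Density

/-! ### Orthogonality of the `Q k` to lower degrees. -/

section Orthogonality

open MeasureTheory

variable {b : ℂ}

lemma one_add_mul_ne_zero (hb : ‖b‖ < 1) {w : ℂ} (hw : ‖w‖ ≤ 1) : 1 + b * w ≠ 0 := by
  intro h
  have h1 : b * w = -1 := by linear_combination h
  have h2 : ‖b * w‖ = 1 := by rw [h1]; simp
  rw [norm_mul] at h2
  nlinarith [norm_nonneg w, norm_nonneg b]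

/-- The product `∏ (1 + b̄ t³)` whose squared modulus is the denominator of the weight. -/
def weightDenom (b : ℂ) (t : Fin 3 → ℂ) : ℂ := ∏ i, (1 + conj b * t i ^ 3)

lemma weightDenom_torusPt_ne_zero (hb : ‖b‖ < 1) (x : Circle × Circle) :
    weightDenom b (torusPt x) ≠ 0 :=
  Finset.prod_ne_zero_iff.2 fun i _ =>
    one_add_mul_ne_zero (by simpa using hb) (by rw [norm_pow, norm_torusPt, one_pow])

lemma continuous_eval_deltoid (κ : ℂ) (f : MvPolynomial (Fin 2) ℂ) :
    Continuous fun x => eval (deltoid κ (torusPt x)) f := by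
  refine (MvPolynomial.continuous_eval f).comp (continuous_pi fun i => ?_)
  fin_cases i <;> simp only [deltoid, Fin.zero_eta, Fin.mk_one, Matrix.cons_val] <;> fun_prop

/-- The square root (up to phase) of the weight function. -/
noncomputable def halfWeight (b : ℂ) (x : Circle × Circle) : ℂ :=
  vand (torusPt x) / weightDenom b (torusPt x)

lemma continuous_halfWeight (hb : ‖b‖ < 1) : Continuous (halfWeight b) := by
  refine Continuous.div ?_ ?_ (weightDenom_torusPt_ne_zero hb)
  · unfold vand; fun_prop
  · unfold weightDenom; fun_prop

/-- The embedding of the polynomials in the weighted `L²` space of the torus. -/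
noncomputable def weightedEmbedding (κ : ℂ) (hb : ‖b‖ < 1) :
    MvPolynomial (Fin 2) ℂ →ₗ[ℂ] Lp ℂ 2 (Measure.haar : Measure (Circle × Circle)) :=
  (ContinuousMap.toLp 2 Measure.haar ℂ).toLinearMap ∘ₗ
    { toFun := fun f => ⟨fun x => eval (deltoid κ (torusPt x)) f * halfWeight b x,
        (continuous_eval_deltoid κ f).mul (continuous_halfWeight hb)⟩
      map_add' := fun f g => by ext x; simp [add_mul]
      map_smul' := fun r f => by ext x; simp [smul_eval, mul_assoc] }

lemma inner_weightedEmbedding (κ : ℂ) (hb : ‖b‖ < 1) (f g : MvPolynomial (Fin 2) ℂ) :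
    inner ℂ (weightedEmbedding κ hb f) (weightedEmbedding κ hb g)
      = ∫ x, (eval (deltoid κ (torusPt x)) g * halfWeight b x)
          * conj (eval (deltoid κ (torusPt x)) f * halfWeight b x) ∂Measure.haar :=
  ContinuousMap.inner_toLp _ _ _

lemma weightedEmbedding_injective {κ : ℂ} (hκ : κ ≠ 0) (hb : ‖b‖ < 1) :
    Function.Injective (weightedEmbedding κ hb) := by
  refine (injective_iff_map_eq_zero _).2 fun f hf => ?_
  have h0 := ContinuousMap.toLp_injective (𝕜 := ℂ) (p := 2)
    (Measure.haar : Measure (Circle × Circle)) (hf.trans (map_zero _).symm)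
  refine eq_zero_of_eval_deltoid hκ fun x => ?_
  have hx : eval (deltoid κ (torusPt x)) f * halfWeight b x = 0 := DFunLike.congr_fun h0 x
  rw [halfWeight, ← mul_div_assoc, div_eq_zero_iff] at hx
  exact hx.resolve_right (weightDenom_torusPt_ne_zero hb x)

/-- Conjugation inverts the `t i`, and since their product is one this exchanges `e₁` and `e₂`.
Hence `X 0` and `X 1` act as mutually adjoint multiplications. -/
lemma conj_deltoid_zero (κ : ℂ) (x : Circle × Circle) :
    conj (deltoid κ (torusPt x) 0) = deltoid κ (torusPt x) 1 := by
  have hp := torusPt_prod x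
  have h0 := torusPt_ne_zero x 0
  have h1 := torusPt_ne_zero x 1
  have h2 := torusPt_ne_zero x 2
  simp only [deltoid, Matrix.cons_val_zero, Matrix.cons_val_one, map_mul, map_add, conj_torusPt]
  congr 1
  field_simp
  linear_combination -(torusPt x 0 + torusPt x 1 + torusPt x 2) * hp

lemma conj_deltoid_one (κ : ℂ) (x : Circle × Circle) :
    conj (deltoid κ (torusPt x) 1) = deltoid κ (torusPt x) 0 := by
  rw [← conj_deltoid_zero, Complex.conj_conj]

lemma conj_vand (x : Circle × Circle) : conj (vand (torusPt x)) = -vand (torusPt x) := by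
  have hp := torusPt_prod x
  have h0 := torusPt_ne_zero x 0
  have h1 := torusPt_ne_zero x 1
  have h2 := torusPt_ne_zero x 2
  have hp2 : (torusPt x 0 * torusPt x 1 * torusPt x 2) ^ 2 = 1 := by rw [hp, one_pow]
  simp only [vand, map_mul, map_sub, conj_torusPt]
  field_simp
  linear_combination ((torusPt x 1 - torusPt x 0) * (torusPt x 2 - torusPt x 0)
    * (torusPt x 2 - torusPt x 1)) * hp2

lemma weightedEmbedding_adjoint (κ : ℂ) (hb : ‖b‖ < 1) (f g : MvPolynomial (Fin 2) ℂ) :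
    inner ℂ (weightedEmbedding κ hb (X 0 * f)) (weightedEmbedding κ hb g)
      = inner ℂ (weightedEmbedding κ hb f) (weightedEmbedding κ hb (X 1 * g)) := by
  rw [inner_weightedEmbedding, inner_weightedEmbedding]
  congr 1
  ext x
  simp only [map_mul, eval_X, conj_deltoid_zero]
  ring

lemma vand_comp_perm (t : Fin 3 → ℂ) (σ : Equiv.Perm (Fin 3)) :
    vand (t ∘ σ) = Equiv.Perm.sign σ * vand t := by
  have h : ∀ u : Fin 3 → ℂ, vand u = (Matrix.of fun (i n : Fin 3) => u i ^ (n : ℕ)).det := by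
    intro u
    rw [Matrix.det_fin_three]
    simp only [Matrix.of_apply, Fin.val_zero, Fin.val_one, Fin.val_two, vand]
    ring
  rw [h, h, ← Matrix.det_permute]
  rfl

lemma deltoid_comp_perm (κ : ℂ) (t : Fin 3 → ℂ) (σ : Equiv.Perm (Fin 3)) :
    deltoid κ (t ∘ σ) = deltoid κ t := by
  have h1 : t (σ 0) + t (σ 1) + t (σ 2) = t 0 + t 1 + t 2 := by
    simpa [Fin.sum_univ_three] using Equiv.sum_comp σ t
  have h2 : t (σ 0) ^ 2 + t (σ 1) ^ 2 + t (σ 2) ^ 2 = t 0 ^ 2 + t 1 ^ 2 + t 2 ^ 2 := by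
    simpa [Fin.sum_univ_three] using Equiv.sum_comp σ fun i => t i ^ 2
  have h3 : t (σ 0) * t (σ 1) + t (σ 0) * t (σ 2) + t (σ 1) * t (σ 2)
      = t 0 * t 1 + t 0 * t 2 + t 1 * t 2 := by
    linear_combination (t (σ 0) + t (σ 1) + t (σ 2) + t 0 + t 1 + t 2) / 2 * h1 - h2 / 2
  simp only [deltoid, Function.comp_apply, h1, h3]

/-- One of the six terms of the integrand in the orthogonality relation. -/
noncomputable def alternantTerm (κ b : ℂ) (m j p q : ℕ) (t : Fin 3 → ℂ) : ℂ :=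
  (1 + conj b * t 0 ^ 3) * (t 1 ^ (m + 2) + b * t 1 ^ (m - 1)) * t 2 ^ (j + 1)
    * (deltoid κ t 1 ^ p * deltoid κ t 0 ^ q) * vand t
    / (weightDenom b t * ∏ i, (1 + b * (t i)⁻¹ ^ 3))

/-- The numerator factors `1 + conj b t₀³` and `1 + b t₁⁻³` cancel the denominator factors with
poles inside the disc; the others are zero-free on the closed disc as `‖b‖ < 1`. The power of the
rotation parameter is `m + 2` from `t₁`, less `p + q` from the deltoid coordinates and `2` from
`vand`, so it is positive. -/
lemma alternantTerm_rotation (hb : ‖b‖ < 1) (κ : ℂ) {m : ℕ} (j : ℕ) {p q : ℕ} (hpq : p + q < m)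
    (t : Fin 3 → ℂ) (ht : ∀ i, ‖t i‖ = 1) :
    ∫ θ in (0 : ℝ)..2 * Real.pi, alternantTerm κ b m j p q
      ![(Circle.exp θ : ℂ)⁻¹ * t 0, Circle.exp θ * t 1, t 2] = 0 := by
  have ht0 : ∀ i, t i ≠ 0 := fun i => by rw [← norm_ne_zero_iff, ht]; exact one_ne_zero
  have hb' : ‖conj b‖ < 1 := by simpa using hb
  -- The total exponent is `l + 1`: one factor `s` for Cauchy's theorem, the rest in `Φ`.
  obtain ⟨l, rfl⟩ : ∃ l, m = p + q + l + 1 := ⟨m - 1 - p - q, by omega⟩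
  let Φ : ℂ → ℂ := fun s =>
    s ^ l * t 1 ^ (p + q + l + 1 + 2) * t 2 ^ (j + 1)
      * ((conj κ * (t 0 + s ^ 2 * t 1 + s * t 2)) ^ p
        * (κ * (s * (t 0 * t 1) + t 0 * t 2 + s ^ 2 * (t 1 * t 2))) ^ q)
      * ((s ^ 2 * t 1 - t 0) * (s * t 2 - t 0) * (t 2 - s * t 1))
      / ((1 + conj b * (s * t 1) ^ 3) * (1 + conj b * t 2 ^ 3)
        * ((1 + b * (s * (t 0)⁻¹) ^ 3) * (1 + b * (t 2)⁻¹ ^ 3)))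
  have hnz : ∀ s : ℂ, ‖s‖ ≤ 1 → 1 + conj b * (s * t 1) ^ 3 ≠ 0 ∧ 1 + conj b * t 2 ^ 3 ≠ 0 ∧
      1 + b * (s * (t 0)⁻¹) ^ 3 ≠ 0 ∧ 1 + b * (t 2)⁻¹ ^ 3 ≠ 0 := by
    intro s hs
    refine ⟨one_add_mul_ne_zero hb' ?_, one_add_mul_ne_zero hb' ?_, one_add_mul_ne_zero hb ?_,
      one_add_mul_ne_zero hb ?_⟩
    · rw [norm_pow, norm_mul, ht, mul_one]; exact pow_le_one₀ (norm_nonneg _) hs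
    · rw [norm_pow, ht, one_pow]
    · rw [norm_pow, norm_mul, norm_inv, ht, inv_one, mul_one]; exact pow_le_one₀ (norm_nonneg _) hs
    · rw [norm_pow, norm_inv, ht, inv_one, one_pow]
  have hΦ : DifferentiableOn ℂ Φ (Metric.closedBall 0 1) := by
    refine DifferentiableOn.div (by fun_prop) (by fun_prop) fun s hs => ?_
    obtain ⟨h1, h2, h3, h4⟩ := hnz s (by simpa using hs)
    exact mul_ne_zero (mul_ne_zero h1 h2) (mul_ne_zero h3 h4)
  rw [← integral_exp_mul_eq_zero hΦ]
  congr 1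
  ext θ
  set s : ℂ := ((Circle.exp θ : Circle) : ℂ) with hs
  have hs1 : ‖s‖ = 1 := Circle.norm_coe _
  have hs0 : s ≠ 0 := by rw [← norm_ne_zero_iff, hs1]; exact one_ne_zero
  obtain ⟨h1, h2, h3, h4⟩ := hnz s hs1.le
  have h5 : 1 + conj b * (s⁻¹ * t 0) ^ 3 ≠ 0 := one_add_mul_ne_zero hb' (by
    rw [norm_pow, norm_mul, norm_inv, hs1, ht]; simp)
  have h6 : 1 + b * (s * t 1)⁻¹ ^ 3 ≠ 0 := one_add_mul_ne_zero hb (by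
    rw [norm_pow, norm_inv, norm_mul, hs1, ht]; simp)
  have e1 : (s * t 1) ^ (p + q + l + 1 + 2) + b * (s * t 1) ^ (p + q + l + 1 - 1)
      = (s * t 1) ^ (p + q + l + 1 + 2) * (1 + b * (s * t 1)⁻¹ ^ 3) := by
    have h1' := ht0 1
    rw [Nat.add_sub_cancel]
    field_simp
    ring
  have e2 : conj κ * (s⁻¹ * t 0 + s * t 1 + t 2)
      = s⁻¹ * (conj κ * (t 0 + s ^ 2 * t 1 + s * t 2)) := by field_simp
  have e3 : κ * (s⁻¹ * t 0 * (s * t 1) + s⁻¹ * t 0 * t 2 + s * t 1 * t 2)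
      = s⁻¹ * (κ * (s * (t 0 * t 1) + t 0 * t 2 + s ^ 2 * (t 1 * t 2))) := by field_simp
  have e4 : (s * t 1 - s⁻¹ * t 0) * (t 2 - s⁻¹ * t 0) * (t 2 - s * t 1)
      = s⁻¹ ^ 2 * ((s ^ 2 * t 1 - t 0) * (s * t 2 - t 0) * (t 2 - s * t 1)) := by field_simp
  have e5 : (s⁻¹ * t 0)⁻¹ = s * (t 0)⁻¹ := by rw [mul_inv, inv_inv]
  simp only [alternantTerm, weightDenom, deltoid, vand, Fin.prod_univ_three, Matrix.cons_val, Φ]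
  rw [e1, e2, e3, e4, e5]
  generalize 1 + conj b * (s * t 1) ^ 3 = d1 at *
  generalize 1 + conj b * t 2 ^ 3 = d2 at *
  generalize 1 + b * (s * (t 0)⁻¹) ^ 3 = d3 at *
  generalize 1 + b * (t 2)⁻¹ ^ 3 = d4 at *
  generalize 1 + conj b * (s⁻¹ * t 0) ^ 3 = d5 at *
  generalize 1 + b * (s * t 1)⁻¹ ^ 3 = d6 at *
  generalize conj κ * (t 0 + s ^ 2 * t 1 + s * t 2) = u1
  generalize κ * (s * (t 0 * t 1) + t 0 * t 2 + s ^ 2 * (t 1 * t 2)) = u0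
  generalize (s ^ 2 * t 1 - t 0) * (s * t 2 - t 0) * (t 2 - s * t 1) = v
  rw [mul_pow s⁻¹ u1, mul_pow s⁻¹ u0, inv_pow, inv_pow, inv_pow]
  field_simp
  ring

lemma integral_alternantTerm (hb : ‖b‖ < 1) (κ : ℂ) {m : ℕ} (j : ℕ) {p q : ℕ} (hpq : p + q < m)
    (σ : Equiv.Perm (Fin 3)) :
    Continuous (fun x => alternantTerm κ b m j p q (torusPt x ∘ σ)) ∧
    ∫ x, alternantTerm κ b m j p q (torusPt x ∘ σ)
      ∂(Measure.haar : Measure (Circle × Circle)) = 0 := by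
  have hcont : Continuous (fun x => alternantTerm κ b m j p q (torusPt x ∘ σ)) := by
    have hinv : ∀ i, Continuous fun x => (torusPt x i)⁻¹ := fun i =>
      Continuous.inv₀ (by fun_prop) fun x => torusPt_ne_zero x i
    refine Continuous.div ?_ ?_ fun x => ?_
    · simp only [deltoid, vand, Function.comp_apply, Matrix.cons_val]
      fun_prop
    · simp only [weightDenom, Function.comp_apply]
      fun_prop
    · refine mul_ne_zero (Finset.prod_ne_zero_iff.2 fun i _ => one_add_mul_ne_zero (by simpa) ?_)
        (Finset.prod_ne_zero_iff.2 fun i _ => one_add_mul_ne_zero hb ?_) <;>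
        simp [norm_torusPt]
  refine ⟨hcont, ?_⟩
  obtain ⟨g, hg, hrot⟩ := exists_rotation σ
  refine integral_eq_zero_of_rotation hcont hg fun x => ?_
  simp only [hrot]
  exact alternantTerm_rotation hb κ j hpq (torusPt x ∘ σ) fun i => norm_torusPt x _

/-- Leibniz expansion of the alternant: `vand` absorbs the sign of `σ` and all other factors are
symmetric, so each term is one fixed function at a permuted point. The overall sign comes from
`conj_vand`. -/
lemma sum_alternantTerm (hb : ‖b‖ < 1) (κ : ℂ) (m j p q : ℕ) (x : Circle × Circle) :
    (alternant b m j (torusPt x)).det / weightDenom b (torusPt x)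
        * conj (deltoid κ (torusPt x) 0 ^ p * deltoid κ (torusPt x) 1 ^ q * halfWeight b x)
      = -∑ σ : Equiv.Perm (Fin 3), alternantTerm κ b m j p q (torusPt x ∘ σ) := by
  set t := torusPt x with ht
  have hwc : conj (weightDenom b t) = ∏ i, (1 + b * (t i)⁻¹ ^ 3) := by
    simp only [weightDenom, map_prod, map_add, map_mul, map_one, map_pow, Complex.conj_conj,
      ht, conj_torusPt]
  have hterm : ∀ σ : Equiv.Perm (Fin 3), alternantTerm κ b m j p q (t ∘ σ)
      = Equiv.Perm.sign σ * (∏ s, alternant b m j t s (σ s))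
        * (deltoid κ t 1 ^ p * deltoid κ t 0 ^ q) * vand t
        / (weightDenom b t * conj (weightDenom b t)) := by
    intro σ
    have h1 : weightDenom b (t ∘ σ) = weightDenom b t :=
      Equiv.prod_comp σ fun i => 1 + conj b * t i ^ 3
    have h2 : ∏ i, (1 + b * ((t ∘ σ) i)⁻¹ ^ 3) = ∏ i, (1 + b * (t i)⁻¹ ^ 3) :=
      Equiv.prod_comp σ fun i => 1 + b * (t i)⁻¹ ^ 3
    have h3 : ∏ s, alternant b m j t s (σ s) = (1 + conj b * t (σ 0) ^ 3)
        * (t (σ 1) ^ (m + 2) + b * t (σ 1) ^ (m - 1)) * t (σ 2) ^ (j + 1) := by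
      rw [Fin.prod_univ_three]
      rfl
    rw [alternantTerm, h1, h2, h3, vand_comp_perm, deltoid_comp_perm, hwc]
    simp only [Function.comp_apply]
    congr 1
    ring
  have hdet : (alternant b m j t).det
      = ∑ σ : Equiv.Perm (Fin 3), (Equiv.Perm.sign σ : ℂ) * ∏ s, alternant b m j t s (σ s) := by
    rw [← Matrix.det_transpose, Matrix.det_apply']
    rfl
  simp only [hterm]
  rw [← Finset.sum_div, ← Finset.sum_mul, ← Finset.sum_mul, ← hdet]
  have hw := weightDenom_torusPt_ne_zero hb x
  rw [halfWeight, map_mul, map_mul, map_pow, map_pow, conj_deltoid_zero, conj_deltoid_one,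
    map_div₀, conj_vand, ← ht]
  field_simp

theorem inner_weightedEmbedding_Q (hb : ‖b‖ < 1) {a c κ : ℂ} (hκ : κ ≠ 0)
    (hκc : κ ^ 2 = c * conj κ) (hab : a = c * (1 + b)) {m : ℕ} (hm : 2 ≤ m) (k : Fin (m + 1)) :
    ∀ f ∈ degLT m, inner ℂ (weightedEmbedding κ hb f) (weightedEmbedding κ hb (Q a c m k)) = 0 := by
  obtain ⟨C, hC⟩ := exists_eval_Q_mul_vand hκ hκc hab hm k
  refine degLT_induction (fun p q hpq => ?_) (by simp) (fun f g hf hg => ?_) fun r f hf => ?_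
  · rw [inner_weightedEmbedding]
    have hfun : ∀ x, (eval (deltoid κ (torusPt x)) (Q a c m k) * halfWeight b x)
          * conj (eval (deltoid κ (torusPt x)) (X 0 ^ p * X 1 ^ q) * halfWeight b x)
        = -C * ∑ σ : Equiv.Perm (Fin 3), alternantTerm κ b m (m - k) p q (torusPt x ∘ σ) := by
      intro x
      have h := sum_alternantTerm hb κ m (m - k) p q x
      have hQ := hC (torusPt x) (torusPt_prod x)
      have e : eval (deltoid κ (torusPt x)) (X 0 ^ p * X 1 ^ q)
          = deltoid κ (torusPt x) 0 ^ p * deltoid κ (torusPt x) 1 ^ q := by simp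
      have e' : eval (deltoid κ (torusPt x)) (Q a c m k) * halfWeight b x
          = C * ((alternant b m (m - k) (torusPt x)).det / weightDenom b (torusPt x)) := by
        rw [halfWeight, ← mul_div_assoc, hQ, mul_div_assoc]
      rw [e, e', mul_assoc, h]
      ring
    simp only [hfun]
    rw [integral_const_mul, integral_finsetSum]
    · rw [Finset.sum_eq_zero fun σ _ => (integral_alternantTerm hb κ (m - k) hpq σ).2, mul_zero]
    · intro σ _
      exact (integral_alternantTerm hb κ (m - k) hpq σ).1.integrable_of_hasCompactSupport
        (HasCompactSupport.of_compactSpace _)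
  · rw [map_add, inner_add_left, hf, hg, add_zero]
  · rw [map_smul, inner_smul_left, hf, mul_zero]

end Orthogonality

/-! ### Choice of parameters and the small cases. -/

section Main

lemma exists_sq_eq_mul_conj {c : ℂ} (hc : c ≠ 0) : ∃ κ : ℂ, κ ≠ 0 ∧ κ ^ 2 = c * conj κ := by
  obtain ⟨w, hw⟩ := IsAlgClosed.exists_pow_nat_eq c (n := 3) (by norm_num)
  have hw0 : w ≠ 0 := by rintro rfl; simp at hw; exact hc hw.symm
  refine ⟨w ^ 2 * conj w, by simpa using hw0, ?_⟩
  rw [← hw, map_mul, map_pow, Complex.conj_conj]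
  ring

theorem separating_Q {a c : ℂ} (hc : c ≠ 0) (hca : ‖c - a‖ < ‖c‖) (m : ℕ) :
    ∀ g ∈ degLT m, (∀ p ∈ commonZeros (Q a c m), IsRealPoint p → eval p g = 0) → g = 0 := by
  have hfin : m = 0 ∨ m = 1 ∨ 2 ≤ m := by omega
  rcases hfin with rfl | rfl | hm
  · intro g hg _
    exact degLT_induction (p := fun g => g = 0) (by simp) rfl
      (fun f g hf hg => by rw [hf, hg, add_zero]) (fun r f hf => by rw [hf, smul_zero]) g hg
  · intro g hg h
    obtain ⟨r, rfl⟩ : ∃ r, g = C r := by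
      refine degLT_induction (p := fun g => ∃ r, g = C r) ?_ ⟨0, by simp⟩ ?_ ?_ g hg
      · intro i j hij
        obtain ⟨rfl, rfl⟩ : i = 0 ∧ j = 0 := by omega
        exact ⟨1, by simp⟩
      · rintro _ _ ⟨r, rfl⟩ ⟨s, rfl⟩
        exact ⟨r + s, by simp⟩
      · rintro s _ ⟨r, rfl⟩
        exact ⟨s * r, by simp [smul_eq_C_mul]⟩
    -- For `m = 1` the two polynomials are `z₁` and `z₀` up to order, so the origin is a real common
    -- zero.
    have h0 := h 0 (fun k => ?_) (by simp [IsRealPoint])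
    · simp only [eval_C] at h0
      rw [h0, C_0]
    · rw [eval_Q, Matrix.det_unique]
      have := (k.rev.succAbove 0).2
      simp [bandMatrix]
      omega
  · obtain ⟨κ, hκ, hκc⟩ := exists_sq_eq_mul_conj hc
    -- Here the size condition on `c - a` keeps the denominator of the weight away from zero.
    have hb : ‖(a - c) / c‖ < 1 := by
      rw [norm_div, norm_sub_rev, div_lt_one (norm_pos_iff.2 hc)]
      exact hca
    have hab : a = c * (1 + (a - c) / c) := by field_simp; ring
    exact separating_of_orthogonal (weightedEmbedding κ hb) (weightedEmbedding_injective hκ hb)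
      (weightedEmbedding_adjoint κ hb) (charPoly_sub_leading_mem_degLT _) (charPoly_syzygy _)
      (inner_weightedEmbedding_Q hb hκ hκc hab hm)

end Main

end GenChar

theorem theorem4p3 (a c : ℂ) (ha : a ≠ 0) (hc : c ≠ 0)
    (hreal : (c * (c - a)).im = 0) (hca : 2 * ‖c - a‖ ≤ ‖c‖) (m : ℕ) :
    (GenChar.commonZeros (GenChar.Q a c m)).encard
        = (Module.finrank ℝ (GenChar.polyDegLT m) : ℕ∞) ∧
      ∀ p ∈ GenChar.commonZeros (GenChar.Q a c m),
        GenChar.IsRealPoint p ∧ GenChar.IsSimpleZero (GenChar.Q a c m) p := by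
  have hlt : ‖c - a‖ < ‖c‖ := by
    have := norm_pos_iff.2 hc
    linarith
  exact GenChar.commonZeros_of_separating (GenChar.charPoly_sub_leading_mem_degLT _)
    (GenChar.separating_Q hc hlt m)
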